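/- For a positive integer $n$, let $\sigma(n)$ be the sum of the positive divisors of $n$, $\varphi(n)$ Euler's totient function, $d(n)$ the number of positive divisors of $n$, $\omega(n)$ the number of distinct prime factors of $n$, and $\Omega(n)$ the number of prime factors of $n$ counted with multiplicity. Let $f=(f(n))_{n\ge 1}$ be a sequence of non-negative integers with $f(n)\neq 0$ for infinitely many $n$, and suppose that there is a constant $\delta>0$ such that $$\sum_{n\le x} f(n)=O\bigl(x(\log x)^{\delta}\bigr)\qquad (x\to\infty).$$ Then, for every integer $t\ge 2$, the series $$\sum_{n=1}^{\infty}\frac{f(n)}{t^{\sigma(n)}}\qquad\text{and}\qquad \sum_{n=1}^{\infty}\frac{f(n)}{t^{\varphi(n)}}$$ converge and their sums are both irrational. In particular, for every integer $k\ge 0$ we have $\sum_{n\le x} d(n)^k=O(x(\log x)^{2^k-1})$, and we have $\sum_{n\le x}2^{\omega(n)}=O(x(\log x)^2)$ and $\sum_{n\le x}2^{\Omega(n)}=O(x(\log x)^2)$ as $x\to\infty$; hence for every integer $t\ge 2$ the two series above have irrational sums for each of the choices $f(n)=d(n)^k$ ($k\ge 0$ an integer), $f(n)=2^{\omega(n)}$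 and $f(n)=2^{\Omega(n)}$. -/

import Mathlib

/-- `∑_{n ≤ x} f(n) = O(x (log x)^δ)` as the real variable `x` tends to infinity.
Sequences start at index `1`; the value `f 0` is never used. -/
def SumIsBigOLogPow (f : ℕ → ℕ) (δ : ℝ) : Prop :=
  Asymptotics.IsBigO Filter.atTop
    (fun x : ℝ => ∑ n ∈ Finset.Icc 1 ⌊x⌋₊, (f n : ℝ))
    (fun x : ℝ => x * Real.log x ^ δ)

/-- The series `∑_{n = 1}^∞ f(n) / t^{g(n)}` converges and its sum is irrational. -/
def IrrationalSeries (f g : ℕ → ℕ) (t : ℕ) : Prop :=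
  ∃ s : ℝ, HasSum (fun n : ℕ => (f (n + 1) : ℝ) / (t : ℝ) ^ g (n + 1)) s ∧ Irrational s

/-- Both `∑_{n ≥ 1} f(n) / t^{σ(n)}` and `∑_{n ≥ 1} f(n) / t^{φ(n)}` converge to
irrational numbers. -/
def IrrationalSigmaPhiSeries (f : ℕ → ℕ) (t : ℕ) : Prop :=
  IrrationalSeries f (fun n => ArithmeticFunction.sigma 1 n) t ∧
    IrrationalSeries f (fun n => Nat.totient n) t

section

open Finset

/-! Write `g` for σ or φ. If the series were rational with denominator `q`, then for every `N` the
tail over `g n > N`, multiplied by `q * t ^ N`, would be a positive integer, hence at least 1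
(`exists_le_tail_of_not_irrational`). The contradiction comes from averaging these tails over many
`N` below `X = 2 ^ 2 ^ (8 * i)`.

The values of `g` are sparse: either `2 ^ i ∣ g n`, or the squarefree part of `n` has at most `i`
prime factors. Integers of the second kind are rare, because the sum of `(1/2) ^ Ω(n)` over `n ≤ N`
is O(N / √log N). Hence `g` takes only O(i X / 2 ^ i) values up to `2 * X`
(`exists_card_values_le`), and at least half of the `N < X` are followed by a gap of length `L = 8 *
i * (e + 2)` free of values.

Summed over such `N`, the tails are small (`sum_tail_le`): terms with `g n ≤ 2 * X` gain a factor `2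
^ (-L)`, which beats the logarithms in the mean of `f`, and the remaining terms contribute O(1). So
`X / (2 * q)` is at most a constant times `X / 2 ^ i`, which fails for large `i`. -/

/-! ### Sums over factorisations and elementary divisor bounds -/

lemma sum_Icc_sum_divisorsAntidiagonal (N : ℕ) (G : ℕ → ℕ → ℝ) :
    ∑ n ∈ Icc 1 N, ∑ x ∈ n.divisorsAntidiagonal, G x.1 x.2 =
      ∑ a ∈ Icc 1 N, ∑ b ∈ Icc 1 (N / a), G a b := by
  rw [Finset.sum_sigma', Finset.sum_sigma']
  refine Finset.sum_bij' (fun x _ => ⟨x.2.1, x.2.2⟩) (fun y _ => ⟨y.1 * y.2, (y.1, y.2)⟩)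
    ?_ ?_ ?_ ?_ ?_
  · rintro ⟨n, a, b⟩ h
    simp only [mem_sigma, mem_Icc, Nat.mem_divisorsAntidiagonal] at h ⊢
    obtain ⟨⟨h1, h2⟩, rfl, h3⟩ := h
    have ha : 0 < a := Nat.pos_of_ne_zero (left_ne_zero_of_mul h3)
    have hb : 0 < b := Nat.pos_of_ne_zero (right_ne_zero_of_mul h3)
    refine ⟨⟨ha, le_trans (Nat.le_mul_of_pos_right a hb) h2⟩, hb, ?_⟩
    rw [Nat.le_div_iff_mul_le ha, mul_comm]
    exact h2
  · rintro ⟨a, b⟩ h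
    simp only [mem_sigma, mem_Icc, Nat.mem_divisorsAntidiagonal] at h ⊢
    obtain ⟨⟨h1, h2⟩, h3, h4⟩ := h
    rw [Nat.le_div_iff_mul_le h1, mul_comm] at h4
    have : 0 < a * b := Nat.mul_pos h1 h3
    exact ⟨⟨this, h4⟩, trivial, this.ne'⟩
  · rintro ⟨n, a, b⟩ h
    simp only [mem_sigma, mem_Icc, Nat.mem_divisorsAntidiagonal] at h
    obtain ⟨_, rfl, _⟩ := h
    rfl
  · rintro ⟨a, b⟩ _
    rfl
  · rintro ⟨n, a, b⟩ _
    rfl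

/-- The pair `(a, b)` determines `n`, so `n ↦ (a, b)` is injective, and nonnegativity of `G` allows
the unused pairs to be added. -/
lemma sum_Icc_le_sum_sum_sq (N : ℕ) (F : ℕ → ℝ) (G : ℕ → ℕ → ℝ) (hG : ∀ a b, 0 ≤ G a b)
    (h : ∀ n ∈ Icc 1 N, ∃ a b, n = a * b ^ 2 ∧ F n ≤ G a b) :
    ∑ n ∈ Icc 1 N, F n ≤ ∑ b ∈ Icc 1 N, ∑ a ∈ Icc 1 (N / b ^ 2), G a b := by
  choose! A B hn hF using h
  rw [Finset.sum_sigma']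
  calc ∑ n ∈ Icc 1 N, F n ≤ ∑ n ∈ Icc 1 N, G (A n) (B n) := Finset.sum_le_sum hF
    _ = ∑ y ∈ (Icc 1 N).image (fun n => (⟨B n, A n⟩ : (_ : ℕ) × ℕ)), G y.2 y.1 := by
        rw [Finset.sum_image]
        intro x hx y hy hxy
        simp only [Sigma.mk.injEq, heq_eq_eq] at hxy
        rw [hn x hx, hn y hy, hxy.1, hxy.2]
    _ ≤ _ := by
        refine Finset.sum_le_sum_of_subset_of_nonneg ?_ fun _ _ _ => hG _ _
        intro y hy
        obtain ⟨n, hnN, rfl⟩ := Finset.mem_image.1 hy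
        have h1 := hn n hnN
        simp only [mem_sigma, mem_Icc] at hnN ⊢
        have hA : 0 < A n := Nat.pos_of_ne_zero (by intro h0; rw [h0] at h1; omega)
        have hB : 0 < B n := Nat.pos_of_ne_zero (by intro h0; rw [h0] at h1; omega)
        have h2 : A n * B n ^ 2 ≤ N := h1 ▸ hnN.2
        refine ⟨⟨hB, ?_⟩, hA, (Nat.le_div_iff_mul_le (by positivity)).2 h2⟩
        nlinarith [Nat.mul_le_mul hA (Nat.mul_le_mul hB (le_refl (B n)))]

lemma card_divisors_mul_le (a b : ℕ) :
    (a * b).divisors.card ≤ a.divisors.card * b.divisors.card := by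
  rw [Nat.divisors_mul]
  exact Finset.card_mul_le

lemma card_divisors_le_two_pow_cardFactors (n : ℕ) :
    n.divisors.card ≤ 2 ^ ArithmeticFunction.cardFactors n := by
  induction n using induction_on_primes with
  | zero => simp
  | one => simp
  | prime_mul p a hp ih =>
    rcases eq_or_ne a 0 with rfl | ha
    · simp
    rw [ArithmeticFunction.cardFactors_mul hp.ne_zero ha,
      ArithmeticFunction.cardFactors_apply_prime hp, pow_add, pow_one]
    refine (card_divisors_mul_le p a).trans (Nat.mul_le_mul ?_ ih)
    rw [hp.divisors]
    exact Finset.card_le_two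

lemma two_pow_cardDistinctFactors_le_card_divisors {n : ℕ} (hn : n ≠ 0) :
    2 ^ ArithmeticFunction.cardDistinctFactors n ≤ n.divisors.card := by
  rw [Nat.card_divisors hn, ArithmeticFunction.cardDistinctFactors_apply,
    ← List.card_toFinset, ← Finset.prod_const]
  refine Finset.prod_le_prod' fun p hp => ?_
  have := (Nat.prime_of_mem_primeFactors hp).factorization_pos_of_dvd hn
    (Nat.dvd_of_mem_primeFactors hp)
  omega

lemma one_add_log_natCast_pos (n : ℕ) : (0 : ℝ) < 1 + Real.log n := by
  have := Real.log_natCast_nonneg n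
  linarith

lemma log_natCast_mono {m n : ℕ} (h : m ≤ n) : Real.log m ≤ Real.log n := by
  rcases Nat.eq_zero_or_pos m with rfl | hm
  · simpa using Real.log_natCast_nonneg n
  · exact Real.log_le_log (by exact_mod_cast hm) (by exact_mod_cast h)

lemma sum_Icc_inv_le_one_add_log (N : ℕ) :
    ∑ n ∈ Icc 1 N, (1 : ℝ) / n ≤ 1 + Real.log N := by
  have := harmonic_le_one_add_log N
  rw [harmonic_eq_sum_Icc] at this
  push_cast at this
  simpa using this

lemma sum_Icc_mul_sum_Icc_le (N : ℕ) (u : ℕ → ℝ) (hu : ∀ n, 0 ≤ u n) :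
    ∑ n ∈ Icc 1 N, ∑ x ∈ n.divisorsAntidiagonal, u x.1 * u x.2 ≤ (∑ n ∈ Icc 1 N, u n) ^ 2 := by
  rw [sum_Icc_sum_divisorsAntidiagonal N (fun a b => u a * u b), sq, Finset.sum_mul_sum]
  refine Finset.sum_le_sum fun a _ => ?_
  exact Finset.sum_le_sum_of_subset_of_nonneg
    (Finset.Icc_subset_Icc_right (Nat.div_le_self _ _)) fun _ _ _ => mul_nonneg (hu _) (hu _)

/-! ### Moments of the divisor function -/

/-- One factor d(n) counts the factorisations `n = ab`; submultiplicativity of d bounds the others.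
This drives both inductions on `k` below. -/
lemma card_divisors_pow_succ_le (k n : ℕ) :
    ((n.divisors.card : ℝ)) ^ (k + 1) ≤
      ∑ x ∈ n.divisorsAntidiagonal,
        (x.1.divisors.card : ℝ) ^ k * (x.2.divisors.card : ℝ) ^ k := by
  have : ((n.divisors.card : ℝ)) ^ (k + 1) =
      ∑ x ∈ n.divisorsAntidiagonal, (n.divisors.card : ℝ) ^ k := by
    rw [Finset.sum_const, nsmul_eq_mul, pow_succ, mul_comm]
    congr 2
    rw [← Nat.map_div_right_divisors, Finset.card_map]
  rw [this]
  refine Finset.sum_le_sum fun x hx => ?_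
  rw [← mul_pow]
  refine pow_le_pow_left₀ (by positivity) ?_ k
  rw [← (Nat.mem_divisorsAntidiagonal.1 hx).1]
  exact_mod_cast card_divisors_mul_le _ _

lemma sum_card_divisors_pow_div_le (k N : ℕ) :
    ∑ n ∈ Icc 1 N, (n.divisors.card : ℝ) ^ k / n ≤ (1 + Real.log N) ^ (2 ^ k) := by
  induction k with
  | zero => simpa using sum_Icc_inv_le_one_add_log N
  | succ k ih =>
    calc ∑ n ∈ Icc 1 N, (n.divisors.card : ℝ) ^ (k + 1) / n
        ≤ ∑ n ∈ Icc 1 N, ∑ x ∈ n.divisorsAntidiagonal,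
          ((x.1.divisors.card : ℝ) ^ k / x.1) * ((x.2.divisors.card : ℝ) ^ k / x.2) := by
          refine Finset.sum_le_sum fun n _ => ?_
          calc _ ≤ (∑ x ∈ n.divisorsAntidiagonal,
                (x.1.divisors.card : ℝ) ^ k * (x.2.divisors.card : ℝ) ^ k) / n :=
                div_le_div_of_nonneg_right (card_divisors_pow_succ_le k n) (by positivity)
            _ = _ := by
                rw [Finset.sum_div]
                refine Finset.sum_congr rfl fun x hx => ?_
                rw [← (Nat.mem_divisorsAntidiagonal.1 hx).1, Nat.cast_mul, div_mul_div_comm]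
      _ ≤ (∑ n ∈ Icc 1 N, (n.divisors.card : ℝ) ^ k / n) ^ 2 :=
          sum_Icc_mul_sum_Icc_le N (fun n => (n.divisors.card : ℝ) ^ k / n)
            (fun n => by positivity)
      _ ≤ ((1 + Real.log N) ^ (2 ^ k)) ^ 2 :=
          pow_le_pow_left₀ (Finset.sum_nonneg fun _ _ => by positivity) ih 2
      _ = _ := by rw [← pow_mul, pow_succ]

/-- For fixed `a`, the sum over `b ≤ N / a` is bounded by induction, and the logarithmic sum over
`a` contributes the exponent `2 ^ k`; then `2 ^ k + (2 ^ k - 1) = 2 ^ (k + 1) - 1`. -/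
lemma sum_card_divisors_pow_le (k N : ℕ) :
    ∑ n ∈ Icc 1 N, (n.divisors.card : ℝ) ^ k ≤ N * (1 + Real.log N) ^ (2 ^ k - 1) := by
  induction k generalizing N with
  | zero => simp
  | succ k ih =>
    have hL := one_add_log_natCast_pos N
    calc ∑ n ∈ Icc 1 N, (n.divisors.card : ℝ) ^ (k + 1)
        ≤ ∑ n ∈ Icc 1 N, ∑ x ∈ n.divisorsAntidiagonal,
          (x.1.divisors.card : ℝ) ^ k * (x.2.divisors.card : ℝ) ^ k :=
          Finset.sum_le_sum fun n _ => card_divisors_pow_succ_le k n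
      _ = ∑ a ∈ Icc 1 N, ∑ b ∈ Icc 1 (N / a),
          (a.divisors.card : ℝ) ^ k * (b.divisors.card : ℝ) ^ k :=
          sum_Icc_sum_divisorsAntidiagonal N
            (fun a b => (a.divisors.card : ℝ) ^ k * (b.divisors.card : ℝ) ^ k)
      _ ≤ ∑ a ∈ Icc 1 N, (a.divisors.card : ℝ) ^ k / a *
            (N * (1 + Real.log N) ^ (2 ^ k - 1)) := by
          refine Finset.sum_le_sum fun a _ => ?_
          rw [← Finset.mul_sum, div_mul_eq_mul_div, mul_div_assoc]
          refine mul_le_mul_of_nonneg_left ((ih (N / a)).trans ?_) (by positivity)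
          rw [mul_div_right_comm]
          have hp := one_add_log_natCast_pos (N / a)
          refine mul_le_mul Nat.cast_div_le
            (pow_le_pow_left₀ hp.le ?_ _) (pow_nonneg hp.le _) (by positivity)
          have := log_natCast_mono (Nat.div_le_self N a)
          linarith
      _ ≤ (1 + Real.log N) ^ (2 ^ k) * (N * (1 + Real.log N) ^ (2 ^ k - 1)) := by
          rw [← Finset.sum_mul]
          exact mul_le_mul_of_nonneg_right (sum_card_divisors_pow_div_le k N) (by positivity)
      _ = _ := by
          have : 2 ^ (k + 1) - 1 = 2 ^ k + (2 ^ k - 1) := by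
            have := Nat.one_le_two_pow (n := k)
            omega
          rw [this, pow_add]
          ring

/-! ### Asymptotic bounds versus bounds valid for every N -/

lemma sumIsBigOLogPow_of_sum_Icc_le {f : ℕ → ℕ} {C : ℝ} {e : ℕ} (hC : 0 ≤ C)
    (h : ∀ N : ℕ, ∑ n ∈ Icc 1 N, (f n : ℝ) ≤ C * (N * (1 + Real.log N) ^ e)) :
    SumIsBigOLogPow f e := by
  refine Asymptotics.IsBigO.of_bound (C * 2 ^ e) ?_
  filter_upwards [Filter.eventually_ge_atTop (Real.exp 1)] with x hx
  have hx0 : 0 < x := (Real.exp_pos 1).trans_le hx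
  have hlog : 1 ≤ Real.log x := (Real.le_log_iff_exp_le hx0).2 hx
  have hfl : Real.log (⌊x⌋₊ : ℕ) ≤ Real.log x := by
    rcases Nat.eq_zero_or_pos ⌊x⌋₊ with h0 | h0
    · rw [h0]; simp; linarith
    · exact Real.log_le_log (by exact_mod_cast h0) (Nat.floor_le hx0.le)
  rw [Real.norm_of_nonneg (Finset.sum_nonneg fun _ _ => by positivity), Real.rpow_natCast,
    Real.norm_of_nonneg (by positivity)]
  refine (h _).trans ?_
  rw [mul_assoc]
  refine mul_le_mul_of_nonneg_left ?_ hC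
  calc (⌊x⌋₊ : ℝ) * (1 + Real.log (⌊x⌋₊ : ℕ)) ^ e ≤ x * (2 * Real.log x) ^ e := by
        have := one_add_log_natCast_pos ⌊x⌋₊
        refine mul_le_mul (Nat.floor_le hx0.le) (pow_le_pow_left₀ this.le ?_ _)
          (by positivity) hx0.le
        linarith
    _ = _ := by rw [mul_pow]; ring

lemma exists_sum_Icc_le_of_sumIsBigOLogPow {f : ℕ → ℕ} {δ : ℝ} (hδ : 0 ≤ δ) (h : SumIsBigOLogPow f δ) :
    ∃ (C : ℝ) (e : ℕ), 0 ≤ C ∧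
      ∀ N : ℕ, 1 ≤ N → ∑ n ∈ Icc 1 N, (f n : ℝ) ≤ C * (N * (1 + Real.log N) ^ e) := by
  obtain ⟨c, hc0, hc⟩ := h.exists_nonneg
  obtain ⟨x₀, hx₀⟩ := Filter.eventually_atTop.1 hc.bound
  -- `M` absorbs every `N` below the threshold `x₀`; the form `1 + log N` keeps the bound positive
  -- at `N = 1`.
  set M := ∑ n ∈ Icc 1 ⌈x₀⌉₊, (f n : ℝ) with hM
  have hM0 : 0 ≤ M := Finset.sum_nonneg fun _ _ => by positivity
  refine ⟨c + M, ⌈δ⌉₊, by positivity, fun N hN => ?_⟩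
  have hN1 : (1 : ℝ) ≤ N := by exact_mod_cast hN
  have hL : 0 ≤ Real.log N := Real.log_natCast_nonneg N
  have h1 : (1 : ℝ) ≤ (1 + Real.log N) ^ ⌈δ⌉₊ := one_le_pow₀ (by linarith)
  have h2 : (1 : ℝ) ≤ N * (1 + Real.log N) ^ ⌈δ⌉₊ := one_le_mul_of_one_le_of_one_le hN1 h1
  rcases le_total x₀ N with hx | hx
  · have := hx₀ N hx
    rw [Nat.floor_natCast, Real.norm_of_nonneg (Finset.sum_nonneg fun _ _ => by positivity),
      Real.norm_of_nonneg (by positivity)] at this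
    refine this.trans ?_
    have h3 : Real.log N ^ δ ≤ (1 + Real.log N) ^ ⌈δ⌉₊ := by
      rw [← Real.rpow_natCast]
      exact (Real.rpow_le_rpow hL (by linarith) hδ).trans
        (Real.rpow_le_rpow_of_exponent_le (by linarith) (Nat.le_ceil δ))
    have h4 : (N : ℝ) * Real.log N ^ δ ≤ N * (1 + Real.log N) ^ ⌈δ⌉₊ :=
      mul_le_mul_of_nonneg_left h3 (by linarith)
    have h5 := mul_le_mul_of_nonneg_left h4 hc0
    nlinarith
  · have : ∑ n ∈ Icc 1 N, (f n : ℝ) ≤ M := by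
      refine Finset.sum_le_sum_of_subset_of_nonneg (Finset.Icc_subset_Icc_right ?_)
        fun _ _ _ => by positivity
      exact_mod_cast hx.trans (Nat.le_ceil x₀)
    nlinarith

/-! ### The mean value of 2 ^ Ω(n) -/

lemma sum_Icc_eq_add_sum_Icc_div {p : ℕ} (hp : 0 < p) (N : ℕ) (F : ℕ → ℝ) :
    ∑ n ∈ Icc 1 N, F n =
      ∑ n ∈ Icc 1 N, (if p ∣ n then 0 else F n) + ∑ m ∈ Icc 1 (N / p), F (p * m) := by
  have h1 : ∑ m ∈ Icc 1 (N / p), F (p * m) = ∑ n ∈ Icc 1 N, (if p ∣ n then F n else 0) := by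
    rw [← Finset.sum_filter]
    refine Finset.sum_bij (fun m _ => p * m) ?_ ?_ ?_ ?_
    · intro m hm
      simp only [mem_Icc, mem_filter] at hm ⊢
      have := (Nat.le_div_iff_mul_le hp).1 hm.2
      rw [mul_comm] at this
      exact ⟨⟨Nat.mul_pos hp hm.1, this⟩, dvd_mul_right _ _⟩
    · intro a _ b _ hab
      exact Nat.eq_of_mul_eq_mul_left hp hab
    · intro n hn
      simp only [mem_Icc, mem_filter] at hn
      obtain ⟨⟨h1, h2⟩, m, rfl⟩ := hn
      refine ⟨m, ?_, rfl⟩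
      rw [mem_Icc, Nat.le_div_iff_mul_le hp, mul_comm]
      exact ⟨Nat.pos_of_mul_pos_left h1, h2⟩
    · intro _ _
      rfl
  rw [h1, ← Finset.sum_add_distrib]
  refine Finset.sum_congr rfl fun n _ => ?_
  split_ifs <;> simp

open ArithmeticFunction in
-- For primes `p ≥ 5` one has `4 ^ 10 ≤ 5 ^ 9 ≤ p ^ 9`. This fails for 2 and 3, which are therefore
-- split off and restored later.
lemma four_pow_cardFactors_pow_le {b : ℕ} (hb : b.Coprime 6) :
    (4 ^ cardFactors b) ^ 10 ≤ b ^ 9 := by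
  induction b using induction_on_primes with
  | zero => simp at hb
  | one => simp
  | prime_mul p a hp ih =>
    have ha0 : a ≠ 0 := by rintro rfl; simp at hb
    have ha : a.Coprime 6 := Nat.Coprime.coprime_mul_left hb
    have hp6 : p.Coprime 6 := Nat.Coprime.coprime_mul_right hb
    have hp5 : 5 ≤ p := by
      by_contra hlt
      have := hp.two_le
      have h4 : p ≤ 4 := by omega
      interval_cases p <;> revert hp6 <;> decide
    rw [cardFactors_mul hp.ne_zero ha0, cardFactors_apply_prime hp, pow_add, pow_one, mul_pow,
      mul_pow]
    exact Nat.mul_le_mul (le_trans (by norm_num) (Nat.pow_le_pow_left hp5 9)) (ih ha)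

open ArithmeticFunction in
lemma four_pow_cardFactors_le_rpow {b : ℕ} (hb : b.Coprime 6) :
    (4 : ℝ) ^ cardFactors b ≤ (b : ℝ) ^ (9 / 10 : ℝ) := by
  have h : ((4 : ℝ) ^ cardFactors b) ^ 10 ≤ ((b : ℝ) ^ (9 / 10 : ℝ)) ^ 10 := by
    have h1 : ((b : ℝ) ^ (9 / 10 : ℝ)) ^ 10 = (b : ℝ) ^ 9 := by
      rw [← Real.rpow_natCast, ← Real.rpow_mul (by positivity), ← Real.rpow_natCast]
      norm_num
    rw [h1]
    exact_mod_cast four_pow_cardFactors_pow_le hb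
  exact le_of_pow_le_pow_left₀ (by norm_num) (by positivity) h

open ArithmeticFunction in
-- Write `n = a * b ^ 2` with `a` squarefree: the weight is `4 ^ Ω(b) * 2 ^ ω(a)`, at most `4 ^ Ω(b)
-- * d(a)`. Summing over `a` leaves `4 ^ Ω(b) / b ^ 2 ≤ b ^ (-11/10)`, which is summable.
lemma exists_sum_two_pow_cardFactors_coprime_six_le :
    ∃ C : ℝ, 0 ≤ C ∧ ∀ N : ℕ,
      ∑ n ∈ Icc 1 N, (if n.Coprime 6 then (2 : ℝ) ^ cardFactors n else 0) ≤
        C * (N * (1 + Real.log N)) := by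
  have hs : Summable (fun b : ℕ => (b : ℝ) ^ (-(11 / 10) : ℝ)) :=
    Real.summable_nat_rpow.2 (by norm_num)
  refine ⟨∑' b : ℕ, (b : ℝ) ^ (-(11 / 10) : ℝ), tsum_nonneg fun _ => by positivity, fun N => ?_⟩
  have hL := one_add_log_natCast_pos N
  calc ∑ n ∈ Icc 1 N, (if n.Coprime 6 then (2 : ℝ) ^ cardFactors n else 0)
      ≤ ∑ b ∈ Icc 1 N, ∑ a ∈ Icc 1 (N / b ^ 2),
        (if b.Coprime 6 then (4 : ℝ) ^ cardFactors b * a.divisors.card else 0) := by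
        refine sum_Icc_le_sum_sum_sq N _ (fun a b => if b.Coprime 6 then
          (4 : ℝ) ^ cardFactors b * a.divisors.card else 0) (fun a b => by positivity) ?_
        intro n hn
        obtain ⟨a, b, rfl, hsq⟩ := Nat.sq_mul_squarefree n
        refine ⟨a, b, mul_comm _ _, ?_⟩
        have hn0 : b ^ 2 * a ≠ 0 := by
          have := (mem_Icc.1 hn).1
          omega
        have ha0 : a ≠ 0 := right_ne_zero_of_mul hn0
        have hb0 : b ^ 2 ≠ 0 := left_ne_zero_of_mul hn0
        split_ifs with h1 h2 h2
        · rw [cardFactors_mul hb0 ha0, cardFactors_pow, pow_add, pow_mul,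
            ← (cardDistinctFactors_eq_cardFactors_iff_squarefree ha0).2 hsq]
          have := two_pow_cardDistinctFactors_le_card_divisors ha0
          norm_num
          exact_mod_cast this
        · exact absurd (Nat.Coprime.coprime_dvd_left
            (dvd_mul_of_dvd_left (dvd_pow_self b two_ne_zero) a) h1) h2
        · positivity
        · rfl
    _ ≤ ∑ b ∈ Icc 1 N, (b : ℝ) ^ (-(11 / 10) : ℝ) * (N * (1 + Real.log N)) := by
        refine Finset.sum_le_sum fun b hb => ?_
        have hb0 : (0 : ℝ) < b := by exact_mod_cast (mem_Icc.1 hb).1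
        by_cases h : b.Coprime 6
        · simp_rw [if_pos h, ← Finset.mul_sum]
          have h1 := sum_card_divisors_pow_le 1 (N / b ^ 2)
          simp only [pow_one, Nat.reduceSub] at h1
          have h2 : (b : ℝ) ^ (-(11 / 10) : ℝ) * (N * (1 + Real.log N)) =
              (b : ℝ) ^ (9 / 10 : ℝ) * (N / (b : ℝ) ^ 2 * (1 + Real.log N)) := by
            have : (b : ℝ) ^ (-(11 / 10) : ℝ) = (b : ℝ) ^ (9 / 10 : ℝ) / (b : ℝ) ^ 2 := by
              rw [← Real.rpow_natCast, ← Real.rpow_sub hb0]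
              norm_num
            rw [this]
            ring
          rw [h2]
          refine mul_le_mul (four_pow_cardFactors_le_rpow h) (h1.trans ?_)
            (Finset.sum_nonneg fun _ _ => by positivity) (by positivity)
          have h3 : ((N / b ^ 2 : ℕ) : ℝ) ≤ N / (b : ℝ) ^ 2 := by
            exact_mod_cast Nat.cast_div_le (α := ℝ) (m := N) (n := b ^ 2)
          refine mul_le_mul h3 ?_ (one_add_log_natCast_pos _).le (by positivity)
          linarith [log_natCast_mono (Nat.div_le_self N (b ^ 2))]
        · simp_rw [if_neg h, Finset.sum_const_zero]
          positivity
    _ ≤ _ := by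
        rw [← Finset.sum_mul]
        exact mul_le_mul_of_nonneg_right (hs.sum_le_tsum _ fun _ _ => by positivity)
          (by positivity)

open ArithmeticFunction in
lemma cardFactors_prime_mul {p m : ℕ} (hp : p.Prime) (hm : m ≠ 0) :
    cardFactors (p * m) = cardFactors m + 1 := by
  rw [cardFactors_mul hp.ne_zero hm, cardFactors_apply_prime hp, add_comm]

open ArithmeticFunction in
lemma exists_sum_two_pow_cardFactors_odd_le :
    ∃ C : ℝ, 0 ≤ C ∧ ∀ N : ℕ,
      ∑ n ∈ Icc 1 N, (if 2 ∣ n then 0 else (2 : ℝ) ^ cardFactors n) ≤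
        C * (N * (1 + Real.log N)) := by
  obtain ⟨C, hC, hU⟩ := exists_sum_two_pow_cardFactors_coprime_six_le
  -- Splitting off multiples of 3 gives V(N) = U(N) + 2 V(N / 3), and `3 * C` solves `c = C + 2 * c
  -- / 3`.
  refine ⟨3 * C, by positivity, fun N => ?_⟩
  induction N using Nat.strong_induction_on with
  | _ N ih =>
    rcases Nat.eq_zero_or_pos N with rfl | hN
    · simp
    rw [sum_Icc_eq_add_sum_Icc_div (p := 3) (by norm_num)]
    have h1 : ∑ n ∈ Icc 1 N, (if 3 ∣ n then 0 else if 2 ∣ n then 0 else (2 : ℝ) ^ cardFactors n)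
        = ∑ n ∈ Icc 1 N, (if n.Coprime 6 then (2 : ℝ) ^ cardFactors n else 0) := by
      refine Finset.sum_congr rfl fun n _ => ?_
      have : n.Coprime 6 ↔ ¬ 2 ∣ n ∧ ¬ 3 ∣ n := by
        rw [show (6 : ℕ) = 2 * 3 from rfl, Nat.coprime_mul_iff_right, Nat.coprime_comm,
          Nat.coprime_comm (n := n) (m := 3), Nat.prime_two.coprime_iff_not_dvd,
          Nat.prime_three.coprime_iff_not_dvd]
      by_cases h2 : 2 ∣ n <;> by_cases h3 : 3 ∣ n <;> simp [this, h2, h3]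
    have h2 : ∑ m ∈ Icc 1 (N / 3), (if 2 ∣ 3 * m then 0 else (2 : ℝ) ^ cardFactors (3 * m))
        = 2 * ∑ m ∈ Icc 1 (N / 3), (if 2 ∣ m then 0 else (2 : ℝ) ^ cardFactors m) := by
      rw [Finset.mul_sum]
      refine Finset.sum_congr rfl fun m hm => ?_
      have hm0 : m ≠ 0 := by have := (mem_Icc.1 hm).1; omega
      rw [cardFactors_prime_mul Nat.prime_three hm0, pow_succ]
      have : 2 ∣ 3 * m ↔ 2 ∣ m := by omega
      by_cases h : 2 ∣ m
      · rw [if_pos (this.2 h), if_pos h, mul_zero]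
      · rw [if_neg (this.not.2 h), if_neg h, mul_comm]
    rw [h1, h2]
    have h3 := hU N
    have h4 := ih (N / 3) (Nat.div_lt_self hN (by norm_num))
    have h5 : ((N / 3 : ℕ) : ℝ) * (1 + Real.log (N / 3 : ℕ)) ≤ N / 3 * (1 + Real.log N) := by
      refine mul_le_mul (by exact_mod_cast Nat.cast_div_le (α := ℝ) (m := N) (n := 3)) ?_
        (one_add_log_natCast_pos _).le (by positivity)
      linarith [log_natCast_mono (Nat.div_le_self N 3)]
    have h6 := mul_le_mul_of_nonneg_left h5 (by positivity : 0 ≤ 3 * C)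
    linarith

open ArithmeticFunction in
lemma exists_sum_two_pow_cardFactors_le :
    ∃ C : ℝ, 0 ≤ C ∧ ∀ N : ℕ,
      ∑ n ∈ Icc 1 N, (2 : ℝ) ^ cardFactors n ≤ C * (N * (1 + Real.log N) ^ 2) := by
  obtain ⟨C, hC, hV⟩ := exists_sum_two_pow_cardFactors_odd_le
  -- For the prime 2 the recursion is W(N) = V(N) + 2 W(N / 2): each of the `1 + Nat.log 2 N`
  -- halvings costs the same amount, whence the second logarithm.
  have key : ∀ N : ℕ, ∑ n ∈ Icc 1 N, (2 : ℝ) ^ cardFactors n ≤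
      C * (N * (1 + Real.log N)) * (1 + Nat.log 2 N) := by
    intro N
    induction N using Nat.strong_induction_on with
    | _ N ih =>
      rcases Nat.lt_or_ge N 2 with hN | hN
      · have h0 : (0 : ℝ) ≤ C * (N * (1 + Real.log N)) := by
          have := one_add_log_natCast_pos N
          positivity
        have h1 : ∑ n ∈ Icc 1 N, (2 : ℝ) ^ cardFactors n =
            ∑ n ∈ Icc 1 N, (if 2 ∣ n then 0 else (2 : ℝ) ^ cardFactors n) := by
          refine Finset.sum_congr rfl fun n hn => ?_
          have := mem_Icc.1 hn
          rw [if_neg (by omega)]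
        rw [h1]
        refine (hV N).trans (le_mul_of_one_le_right h0 ?_)
        have : (0 : ℝ) ≤ Nat.log 2 N := by positivity
        linarith
      rw [sum_Icc_eq_add_sum_Icc_div (p := 2) (by norm_num)]
      have h2 : ∑ m ∈ Icc 1 (N / 2), (2 : ℝ) ^ cardFactors (2 * m)
          = 2 * ∑ m ∈ Icc 1 (N / 2), (2 : ℝ) ^ cardFactors m := by
        rw [Finset.mul_sum]
        refine Finset.sum_congr rfl fun m hm => ?_
        have hm0 : m ≠ 0 := by have := (mem_Icc.1 hm).1; omega
        rw [cardFactors_prime_mul Nat.prime_two hm0, pow_succ, mul_comm]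
      rw [h2]
      have h3 := hV N
      have h4 := ih (N / 2) (Nat.div_lt_self (by omega) (by norm_num))
      have h5 : ((N / 2 : ℕ) : ℝ) * (1 + Real.log (N / 2 : ℕ)) ≤ N / 2 * (1 + Real.log N) := by
        refine mul_le_mul (by exact_mod_cast Nat.cast_div_le (α := ℝ) (m := N) (n := 2)) ?_
          (one_add_log_natCast_pos _).le (by positivity)
        linarith [log_natCast_mono (Nat.div_le_self N 2)]
      have h7 : (Nat.log 2 N : ℝ) = 1 + Nat.log 2 (N / 2) := by
        rw [Nat.log_of_one_lt_of_le (by norm_num) hN]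
        push_cast
        ring
      have h6 := mul_le_mul_of_nonneg_right (mul_le_mul_of_nonneg_left h5 hC)
        (by positivity : (0 : ℝ) ≤ 1 + Nat.log 2 (N / 2))
      rw [h7]
      linarith
  refine ⟨C * 2, by positivity, fun N => (key N).trans ?_⟩
  have h0 := one_add_log_natCast_pos N
  have h1 : (1 + Nat.log 2 N : ℝ) ≤ 2 * (1 + Real.log N) := by
    rcases Nat.eq_zero_or_pos N with rfl | hN
    · simp
    have h2 : (Nat.log 2 N : ℝ) * Real.log 2 ≤ Real.log N := by
      rw [← Real.log_pow]
      refine Real.log_le_log (by positivity) ?_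
      exact_mod_cast Nat.pow_log_le_self 2 hN.ne'
    have h3 := Real.log_two_gt_d9
    have h4 : (0 : ℝ) ≤ Nat.log 2 N := by positivity
    nlinarith
  calc _ ≤ C * (N * (1 + Real.log N)) * (2 * (1 + Real.log N)) :=
        mul_le_mul_of_nonneg_left h1 (by positivity)
    _ = _ := by ring

/-! ### Rarity of integers whose squarefree part has few prime factors -/

open ArithmeticFunction in
-- The weight is completely multiplicative, so the square is at most the sum of `d(n) * 2 ^ (-Ω(n))
-- / n` over `n ≤ N ^ 2`, and `d(n) ≤ 2 ^ Ω(n)` leaves a harmonic sum.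
lemma sq_sum_half_pow_cardFactors_div_le (N : ℕ) :
    (∑ n ∈ Icc 1 N, (1 / 2 : ℝ) ^ cardFactors n / n) ^ 2 ≤ 1 + 2 * Real.log N := by
  set u : ℕ → ℝ := fun n => (1 / 2 : ℝ) ^ cardFactors n / n with hu
  have hu0 : ∀ n, 0 ≤ u n := fun n => by positivity
  calc (∑ n ∈ Icc 1 N, u n) ^ 2 = ∑ a ∈ Icc 1 N, ∑ b ∈ Icc 1 N, u a * u b := by
        rw [sq, Finset.sum_mul_sum]
    _ ≤ ∑ a ∈ Icc 1 N, ∑ b ∈ Icc 1 (N ^ 2 / a), u a * u b := by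
        refine Finset.sum_le_sum fun a ha => ?_
        refine Finset.sum_le_sum_of_subset_of_nonneg (Finset.Icc_subset_Icc_right ?_)
          fun _ _ _ => mul_nonneg (hu0 _) (hu0 _)
        rw [mem_Icc] at ha
        rw [Nat.le_div_iff_mul_le ha.1, sq]
        exact Nat.mul_le_mul_left N ha.2
    _ ≤ ∑ a ∈ Icc 1 (N ^ 2), ∑ b ∈ Icc 1 (N ^ 2 / a), u a * u b := by
        refine Finset.sum_le_sum_of_subset_of_nonneg
          (Finset.Icc_subset_Icc_right (Nat.le_self_pow two_ne_zero N)) fun _ _ _ =>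
          Finset.sum_nonneg fun _ _ => mul_nonneg (hu0 _) (hu0 _)
    _ = ∑ n ∈ Icc 1 (N ^ 2), ∑ x ∈ n.divisorsAntidiagonal, u x.1 * u x.2 :=
        (sum_Icc_sum_divisorsAntidiagonal _ (fun a b => u a * u b)).symm
    _ ≤ ∑ n ∈ Icc 1 (N ^ 2), (1 : ℝ) / n := by
        refine Finset.sum_le_sum fun n hn => ?_
        have h1 : ∀ x ∈ n.divisorsAntidiagonal, u x.1 * u x.2 = u n := by
          intro x hx
          rw [Nat.mem_divisorsAntidiagonal] at hx
          obtain ⟨h1, h2⟩ := hx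
          rw [← h1] at h2
          simp only [hu]
          rw [← h1, cardFactors_mul (left_ne_zero_of_mul h2) (right_ne_zero_of_mul h2), pow_add,
            Nat.cast_mul, div_mul_div_comm]
        rw [Finset.sum_congr rfl h1, Finset.sum_const, nsmul_eq_mul]
        have h2 : n.divisorsAntidiagonal.card = n.divisors.card := by
          rw [← Nat.map_div_right_divisors, Finset.card_map]
        rw [h2, hu, ← mul_div_assoc]
        refine div_le_div_of_nonneg_right ?_ (by positivity)
        have h3 : (n.divisors.card : ℝ) ≤ 2 ^ cardFactors n := by
          exact_mod_cast card_divisors_le_two_pow_cardFactors n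
        rw [one_div, inv_pow, ← div_eq_mul_inv]
        exact (div_le_one (by positivity)).2 h3
    _ ≤ 1 + Real.log (N ^ 2 : ℕ) := sum_Icc_inv_le_one_add_log _
    _ = _ := by push_cast; rw [Real.log_pow]; norm_num

open ArithmeticFunction in
-- Expand log n as the sum of Λ(b) over `b ∣ n`, drop the weight of `b`, and apply Chebyshev's bound
-- for ψ(N / a).
lemma sum_half_pow_cardFactors_mul_log_le (N : ℕ) :
    ∑ n ∈ Icc 1 N, (1 / 2 : ℝ) ^ cardFactors n * Real.log n ≤
      (Real.log 4 + 4) * N * ∑ n ∈ Icc 1 N, (1 / 2 : ℝ) ^ cardFactors n / n := by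
  calc ∑ n ∈ Icc 1 N, (1 / 2 : ℝ) ^ cardFactors n * Real.log n
      ≤ ∑ n ∈ Icc 1 N, ∑ x ∈ n.divisorsAntidiagonal,
        (1 / 2 : ℝ) ^ cardFactors x.1 * vonMangoldt x.2 := by
        refine Finset.sum_le_sum fun n _ => ?_
        rw [← vonMangoldt_sum, ← Nat.sum_divisorsAntidiagonal' (fun _ b => vonMangoldt b),
          Finset.mul_sum]
        refine Finset.sum_le_sum fun x hx => mul_le_mul_of_nonneg_right ?_ vonMangoldt_nonneg
        rw [Nat.mem_divisorsAntidiagonal] at hx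
        obtain ⟨h1, h2⟩ := hx
        rw [← h1] at h2
        rw [← h1, cardFactors_mul (left_ne_zero_of_mul h2) (right_ne_zero_of_mul h2)]
        exact pow_le_pow_of_le_one (by norm_num) (by norm_num) (Nat.le_add_right _ _)
    _ = ∑ a ∈ Icc 1 N, ∑ b ∈ Icc 1 (N / a), (1 / 2 : ℝ) ^ cardFactors a * vonMangoldt b :=
        sum_Icc_sum_divisorsAntidiagonal N
          (fun a b => (1 / 2 : ℝ) ^ cardFactors a * vonMangoldt b)
    _ ≤ ∑ a ∈ Icc 1 N, (Real.log 4 + 4) * N * ((1 / 2 : ℝ) ^ cardFactors a / a) := by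
        refine Finset.sum_le_sum fun a _ => ?_
        rw [← Finset.mul_sum]
        have h1 : ∑ b ∈ Icc 1 (N / a), vonMangoldt b = Chebyshev.psi ((N : ℝ) / a) := by
          rw [Chebyshev.psi, Nat.floor_div_natCast, Nat.floor_natCast]
          rfl
        have h2 := Chebyshev.psi_le_const_mul_self (x := (N : ℝ) / a) (by positivity)
        rw [h1]
        calc _ ≤ (1 / 2 : ℝ) ^ cardFactors a * ((Real.log 4 + 4) * ((N : ℝ) / a)) :=
              mul_le_mul_of_nonneg_left h2 (by positivity)
          _ = _ := by ring
    _ = _ := by rw [Finset.mul_sum]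

open ArithmeticFunction in
-- From `log N ≤ log n + N / n`, the sum times log N is O(N H), where `H`, the same sum weighted by
-- `1 / n`, is at most `2 * √(log N)`. The constant is `14 = 7 * 2`, since `log 4 + 5 ≤ 7`.
lemma sum_half_pow_cardFactors_le {N : ℕ} (hN : 2 ≤ N) :
    ∑ n ∈ Icc 1 N, (1 / 2 : ℝ) ^ cardFactors n ≤ 14 * (N / √(Real.log N)) := by
  set T := ∑ n ∈ Icc 1 N, (1 / 2 : ℝ) ^ cardFactors n with hT
  set H := ∑ n ∈ Icc 1 N, (1 / 2 : ℝ) ^ cardFactors n / n with hH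
  have hN0 : (0 : ℝ) < N := by exact_mod_cast (by omega : 0 < N)
  have hlog : 1 / 2 ≤ Real.log N := by
    have h1 : Real.log 2 ≤ Real.log N := Real.log_le_log (by norm_num) (by exact_mod_cast hN)
    linarith [Real.log_two_gt_d9]
  have h1 : T * Real.log N ≤ (Real.log 4 + 5) * N * H := by
    have h2 : T * Real.log N ≤ ∑ n ∈ Icc 1 N, ((1 / 2 : ℝ) ^ cardFactors n * Real.log n +
        N * ((1 / 2 : ℝ) ^ cardFactors n / n)) := by
      rw [hT, Finset.sum_mul]
      refine Finset.sum_le_sum fun n hn => ?_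
      have hn0 : (0 : ℝ) < n := by exact_mod_cast (mem_Icc.1 hn).1
      have h3 : Real.log N ≤ Real.log n + N / n := by
        have h4 := Real.log_le_sub_one_of_pos (div_pos hN0 hn0)
        rw [Real.log_div hN0.ne' hn0.ne'] at h4
        linarith
      calc _ ≤ (1 / 2 : ℝ) ^ cardFactors n * (Real.log n + N / n) :=
            mul_le_mul_of_nonneg_left h3 (by positivity)
        _ = _ := by ring
    rw [Finset.sum_add_distrib, ← Finset.mul_sum] at h2
    have h3 := sum_half_pow_cardFactors_mul_log_le N
    rw [← hH] at h2 h3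
    linarith
  have hH0 : 0 ≤ H := Finset.sum_nonneg fun _ _ => by positivity
  have h4 : H ≤ 2 * √(Real.log N) := by
    refine le_of_pow_le_pow_left₀ two_ne_zero (by positivity) ?_
    rw [mul_pow, Real.sq_sqrt (by linarith)]
    linarith [sq_sum_half_pow_cardFactors_div_le N]
  have h5 : Real.log 4 ≤ 2 := by
    rw [show (4 : ℝ) = 2 ^ 2 by norm_num, Real.log_pow]
    have := Real.log_two_lt_d9
    push_cast
    linarith
  have hs : 0 < √(Real.log N) := Real.sqrt_pos.2 (by linarith)
  rw [← mul_div_assoc, le_div_iff₀ hs]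
  have h6 : (Real.log 4 + 5) * N * H ≤ 7 * N * (2 * √(Real.log N)) :=
    mul_le_mul (by nlinarith) h4 hH0 (by positivity)
  have h7 : T * Real.log N = T * √(Real.log N) * √(Real.log N) := by
    rw [mul_assoc, Real.mul_self_sqrt (by linarith)]
  rw [h7] at h1
  refine le_of_mul_le_mul_right (h1.trans (h6.trans_eq ?_)) hs
  ring

open ArithmeticFunction in
lemma sum_half_pow_cardFactors_le_self (N : ℕ) :
    ∑ n ∈ Icc 1 N, (1 / 2 : ℝ) ^ cardFactors n ≤ N := by
  calc _ ≤ ∑ n ∈ Icc 1 N, (1 : ℝ) :=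
        Finset.sum_le_sum fun _ _ => pow_le_one₀ (by norm_num) (by norm_num)
    _ = N := by simp

open ArithmeticFunction in
lemma sum_half_pow_cardFactors_div_sq_le {N b : ℕ} (hN : 9 ≤ N) (hb : 1 ≤ b) :
    ∑ a ∈ Icc 1 (N / b ^ 2), (1 / 2 : ℝ) ^ cardFactors a ≤
      28 * (N / √(Real.log N)) * (b : ℝ) ^ (-(3 / 2) : ℝ) := by
  have hb1 : (1 : ℝ) ≤ b := by exact_mod_cast hb
  have hb0 : (0 : ℝ) < b := by linarith
  have hN0 : (0 : ℝ) < N := by exact_mod_cast (by omega : 0 < N)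
  have hlog : 0 < Real.log N := Real.log_pos (by exact_mod_cast (by omega : 1 < N))
  have hs : 0 < √(Real.log N) := Real.sqrt_pos.2 hlog
  have hM : ((N / b ^ 2 : ℕ) : ℝ) ≤ N / (b : ℝ) ^ 2 := by
    exact_mod_cast Nat.cast_div_le (α := ℝ) (m := N) (n := b ^ 2)
  have hpow : (b : ℝ) ^ (-(3 / 2) : ℝ) = √b / (b : ℝ) ^ 2 := by
    rw [Real.sqrt_eq_rpow, ← Real.rpow_natCast, ← Real.rpow_sub hb0]
    norm_num
  have hsb : 1 ≤ √(b : ℝ) := Real.one_le_sqrt.2 hb1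
  rw [hpow]
  -- If `b ^ 4 ≤ N`, then `M = N / b ^ 2` is about √N or larger, so log M is comparable to log N.
  -- Otherwise `log N ≤ 4 * b`, and the trivial bound `N / b ^ 2` loses only a factor √b.
  rcases le_or_gt (b ^ 4) N with h | h
  · set M := N / b ^ 2 with hMdef
    have h1 : N < (M + 1) ^ 2 := by
      have h2 : N < b ^ 2 * (M + 1) := Nat.lt_mul_div_succ N (by positivity)
      have h3 : N * N < N * (M + 1) ^ 2 := by
        calc N * N < (b ^ 2 * (M + 1)) * (b ^ 2 * (M + 1)) := Nat.mul_lt_mul'' h2 h2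
          _ = b ^ 4 * (M + 1) ^ 2 := by ring
          _ ≤ N * (M + 1) ^ 2 := Nat.mul_le_mul_right _ h
      exact lt_of_mul_lt_mul_left h3 (Nat.zero_le _)
    have hM2 : 2 ≤ M := by
      by_contra hlt
      have : M + 1 ≤ 2 := by omega
      have := Nat.pow_le_pow_left this 2
      omega
    have h2 : N ≤ M ^ 4 := by
      have : M + 1 ≤ M ^ 2 := by nlinarith
      have := Nat.pow_le_pow_left this 2
      rw [← pow_mul] at this
      exact (h1.trans_le this).le
    have h3 : Real.log N ≤ 4 * Real.log M := by
      have := log_natCast_mono h2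
      push_cast at this
      rw [Real.log_pow] at this
      exact_mod_cast this
    have h4 : √(Real.log N) ≤ 2 * √(Real.log M) := by
      rw [show (2 : ℝ) = √4 by rw [show (4 : ℝ) = 2 ^ 2 by norm_num]; simp,
        ← Real.sqrt_mul (by norm_num)]
      exact Real.sqrt_le_sqrt h3
    have hsM : 0 < √(Real.log M) := by linarith
    calc _ ≤ 14 * (M / √(Real.log M)) := sum_half_pow_cardFactors_le hM2
      _ ≤ 28 * ((M : ℝ) / √(Real.log N)) := by
          rw [← mul_div_assoc, ← mul_div_assoc, div_le_div_iff₀ hsM hs]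
          have : (0 : ℝ) ≤ 14 * M := by positivity
          nlinarith
      _ ≤ 28 * (N / (b : ℝ) ^ 2 / √(Real.log N)) := by gcongr
      _ = 28 * (N / √(Real.log N)) * (1 / (b : ℝ) ^ 2) := by ring
      _ ≤ _ := by gcongr
  · have h1 : Real.log N ≤ 4 * b := by
      have := log_natCast_mono h.le
      push_cast at this
      rw [Real.log_pow] at this
      have h2 := Real.log_le_sub_one_of_pos hb0
      push_cast at this
      linarith
    have h2 : √(Real.log N) ≤ 2 * √b := by
      rw [show (2 : ℝ) = √4 by rw [show (4 : ℝ) = 2 ^ 2 by norm_num]; simp,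
        ← Real.sqrt_mul (by norm_num)]
      exact Real.sqrt_le_sqrt h1
    calc _ ≤ ((N / b ^ 2 : ℕ) : ℝ) := sum_half_pow_cardFactors_le_self _
      _ ≤ N / (b : ℝ) ^ 2 * 1 := by rw [mul_one]; exact hM
      _ ≤ N / (b : ℝ) ^ 2 * (28 * √b / √(Real.log N)) := by
          refine mul_le_mul_of_nonneg_left ?_ (by positivity)
          rw [le_div_iff₀ hs]
          linarith
      _ = _ := by ring

open ArithmeticFunction in
/-- Integers whose squarefree part has few prime factors are rare. -/
lemma exists_card_cardFactors_squarefree_part_le :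
    ∃ C : ℝ, 0 ≤ C ∧ ∀ K N : ℕ, 9 ≤ N → ∀ S ⊆ Icc 1 N,
      (∀ n ∈ S, ∃ a b, n = a * b ^ 2 ∧ cardFactors a ≤ K) →
      (S.card : ℝ) ≤ C * 2 ^ K * (N / √(Real.log N)) := by
  have hs : Summable (fun b : ℕ => (b : ℝ) ^ (-(3 / 2) : ℝ)) :=
    Real.summable_nat_rpow.2 (by norm_num)
  refine ⟨28 * ∑' b : ℕ, (b : ℝ) ^ (-(3 / 2) : ℝ),
    mul_nonneg (by norm_num) (tsum_nonneg fun _ => by positivity), fun K N hN S hS h => ?_⟩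
  calc (S.card : ℝ) = ∑ n ∈ Icc 1 N, (if n ∈ S then (1 : ℝ) else 0) := by
        rw [Finset.sum_ite_mem, Finset.inter_eq_right.2 hS]
        simp
    _ ≤ ∑ b ∈ Icc 1 N, ∑ a ∈ Icc 1 (N / b ^ 2), 2 ^ K * (1 / 2 : ℝ) ^ cardFactors a := by
        refine sum_Icc_le_sum_sum_sq N _ (fun a _ => 2 ^ K * (1 / 2 : ℝ) ^ cardFactors a)
          (fun _ _ => by positivity) fun n _ => ?_
        -- Rankin's trick: `Ω(a) ≤ K` makes `2 ^ K * (1/2) ^ Ω(a)` at least 1. Off `S` any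
        -- factorisation will do.
        split_ifs with hnS
        · obtain ⟨a, b, hn, ha⟩ := h n hnS
          refine ⟨a, b, hn, ?_⟩
          rw [one_div, inv_pow, ← div_eq_mul_inv, one_le_div (by positivity)]
          exact pow_le_pow_right₀ (by norm_num) ha
        · exact ⟨n, 1, by simp, by positivity⟩
    _ ≤ ∑ b ∈ Icc 1 N, 2 ^ K * (28 * (N / √(Real.log N)) * (b : ℝ) ^ (-(3 / 2) : ℝ)) := by
        refine Finset.sum_le_sum fun b hb => ?_
        rw [← Finset.mul_sum]
        exact mul_le_mul_of_nonneg_left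
          (sum_half_pow_cardFactors_div_sq_le hN (mem_Icc.1 hb).1) (by positivity)
    _ = 28 * (∑ b ∈ Icc 1 N, (b : ℝ) ^ (-(3 / 2) : ℝ)) * 2 ^ K * (N / √(Real.log N)) := by
        rw [← Finset.mul_sum, ← Finset.mul_sum]
        ring
    _ ≤ _ := by
        gcongr
        exact hs.sum_le_tsum _ fun _ _ => by positivity

/-! ### Powers of two dividing σ(n) and φ(n), and lower bounds for both -/

/-- If all but at most one of the primes in `S` contribute an even factor, the product is divisible
by a large power of two. -/
lemma two_pow_dvd_prod {S T : Finset ℕ} (hST : S ⊆ T) {K : ℕ} (hK : K + 1 ≤ S.card) {F : ℕ → ℕ}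
    (hF : ∀ p ∈ S, p ≠ 2 → 2 ∣ F p) : 2 ^ K ∣ ∏ p ∈ T, F p := by
  have h1 : K ≤ (S.erase 2).card := by
    have := Finset.pred_card_le_card_erase (s := S) (a := 2)
    omega
  calc 2 ^ K ∣ 2 ^ (S.erase 2).card := pow_dvd_pow 2 h1
    _ = ∏ p ∈ S.erase 2, 2 := by rw [Finset.prod_const]
    _ ∣ ∏ p ∈ S.erase 2, F p :=
        Finset.prod_dvd_prod_of_dvd _ _ fun p hp =>
          hF p (Finset.mem_of_mem_erase hp) (Finset.ne_of_mem_erase hp)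
    _ ∣ ∏ p ∈ T, F p :=
        Finset.prod_dvd_prod_of_subset _ _ _ ((Finset.erase_subset _ _).trans hST)

lemma cardDistinctFactors_eq_card_primeFactors (n : ℕ) :
    ArithmeticFunction.cardDistinctFactors n = n.primeFactors.card := by
  rw [ArithmeticFunction.cardDistinctFactors_apply, ← List.card_toFinset]
  rfl

open ArithmeticFunction in
-- A prime `p ∣ a` has odd exponent in `a * b ^ 2`, so for odd `p` its factor `1 + p + ⋯` has an
-- even number of odd terms. The prime 2 may be lost, hence `K + 1`.
lemma two_pow_dvd_sigma_one {K a b : ℕ} (hb : b ≠ 0) (ha : Squarefree a)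
    (hK : K + 1 ≤ cardFactors a) : 2 ^ K ∣ sigma 1 (a * b ^ 2) := by
  have ha0 : a ≠ 0 := ha.ne_zero
  have hn0 : a * b ^ 2 ≠ 0 := mul_ne_zero ha0 (pow_ne_zero 2 hb)
  rw [← (cardDistinctFactors_eq_cardFactors_iff_squarefree ha0).2 ha,
    cardDistinctFactors_eq_card_primeFactors] at hK
  rw [sigma_one_apply, Nat.sum_divisors hn0]
  refine two_pow_dvd_prod (Nat.primeFactors_mono (dvd_mul_right a _) hn0) hK fun p hp hp2 => ?_
  have hpp := Nat.prime_of_mem_primeFactors hp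
  have hodd : Odd p := hpp.odd_of_ne_two hp2
  have h1 : a.factorization p = 1 := by
    have h2 := (Nat.squarefree_iff_factorization_le_one ha0).1 ha p
    have h3 := hpp.factorization_pos_of_dvd ha0 (Nat.dvd_of_mem_primeFactors hp)
    omega
  rw [← even_iff_two_dvd, Finset.even_sum_iff_even_card_odd,
    Finset.filter_true_of_mem fun k _ => hodd.pow, Finset.card_range,
    Nat.factorization_mul ha0 (pow_ne_zero 2 hb), Nat.factorization_pow]
  simp only [Finsupp.add_apply, Finsupp.smul_apply, h1, smul_eq_mul]
  exact ⟨1 + b.factorization p, by ring⟩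

lemma two_pow_dvd_totient {K n : ℕ} (hn : n ≠ 0) (hK : K + 1 ≤ n.primeFactors.card) :
    2 ^ K ∣ n.totient := by
  rw [Nat.totient_eq_prod_factorization hn, Finsupp.prod, Nat.support_factorization]
  refine two_pow_dvd_prod subset_rfl hK fun p hp hp2 => dvd_mul_of_dvd_right ?_ _
  have hodd : Odd p := (Nat.prime_of_mem_primeFactors hp).odd_of_ne_two hp2
  exact even_iff_two_dvd.1 (hodd.tsub_odd odd_one)

/-- In increasing order the `j`-th element is at least `j + 1`, so the product of `p / (p - 1)` is
at most the telescoping product of `(j + 1) / j`. -/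
lemma prod_le_card_succ_mul_prod_pred (s : Finset ℕ) (hs : ∀ p ∈ s, 2 ≤ p) :
    ∏ p ∈ s, p ≤ (s.card + 1) * ∏ p ∈ s, (p - 1) := by
  induction s using Finset.induction_on_max with
  | empty => simp
  | insert a s hmax ih =>
    have ha : a ∉ s := fun h => lt_irrefl _ (hmax a h)
    have h1 : s.card + 2 ≤ a := by
      have h2 : s ⊆ Ico 2 a := fun p hp =>
        mem_Ico.2 ⟨hs p (mem_insert_of_mem hp), hmax p hp⟩
      have h3 := Finset.card_le_card h2
      have h4 := hs a (mem_insert_self a s)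
      rw [Nat.card_Ico] at h3
      omega
    rw [Finset.prod_insert ha, Finset.prod_insert ha, Finset.card_insert_of_notMem ha]
    have h5 := ih fun p hp => hs p (mem_insert_of_mem hp)
    obtain ⟨c, rfl⟩ : ∃ c, a = c + 1 := ⟨a - 1, by omega⟩
    rw [Nat.add_sub_cancel]
    set P := ∏ p ∈ s, (p - 1)
    calc (c + 1) * ∏ p ∈ s, p ≤ (c + 1) * ((s.card + 1) * P) := Nat.mul_le_mul_left _ h5
      _ = ((c + 1) * (s.card + 1)) * P := by ring
      _ ≤ ((s.card + 1 + 1) * c) * P := Nat.mul_le_mul_right _ (by nlinarith)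
      _ = _ := by ring

lemma le_card_primeFactors_succ_mul_totient (n : ℕ) :
    n ≤ (n.primeFactors.card + 1) * n.totient := by
  have h1 := Nat.totient_mul_prod_primeFactors n
  have h2 := prod_le_card_succ_mul_prod_pred n.primeFactors
    fun p hp => (Nat.prime_of_mem_primeFactors hp).two_le
  have h3 : 0 < ∏ p ∈ n.primeFactors, (p - 1) := Finset.prod_pos fun p hp => by
    have := (Nat.prime_of_mem_primeFactors hp).two_le
    omega
  refine le_of_mul_le_mul_right ?_ h3
  rw [← h1]
  calc _ ≤ n.totient * ((n.primeFactors.card + 1) * ∏ p ∈ n.primeFactors, (p - 1)) :=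
        Nat.mul_le_mul_left _ h2
    _ = _ := by ring

lemma card_primeFactors_le_log {n : ℕ} (hn : n ≠ 0) : n.primeFactors.card ≤ Nat.log 2 n := by
  refine Nat.le_log_of_pow_le one_lt_two ?_
  rw [← cardDistinctFactors_eq_card_primeFactors]
  exact (two_pow_cardDistinctFactors_le_card_divisors hn).trans (Nat.card_divisors_le_self n)

lemma le_log_succ_mul_totient (n : ℕ) : n ≤ (Nat.log 2 n + 1) * n.totient := by
  rcases eq_or_ne n 0 with rfl | hn
  · simp
  · exact (le_card_primeFactors_succ_mul_totient n).trans
      (Nat.mul_le_mul_right _ (Nat.succ_le_succ (card_primeFactors_le_log hn)))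

open ArithmeticFunction in
lemma le_sigma_one (n : ℕ) : n ≤ sigma 1 n := by
  rcases eq_or_ne n 0 with rfl | hn
  · simp
  · rw [sigma_one_apply]
    exact Finset.single_le_sum (f := fun d => d) (fun _ _ => Nat.zero_le _)
      (Nat.mem_divisors_self n hn)

open ArithmeticFunction in
/-- For each `K`, the value `g n` is divisible by `2 ^ K` unless the squarefree part of `n` has at
most `K` prime factors; in the latter case `n` is not much larger than `g n`. -/
def TwoPowDvdOrFewFactors (g : ℕ → ℕ) : Prop :=
  ∀ K n : ℕ, 1 ≤ n → 2 ^ K ∣ g n ∨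
    ((∃ a b, n = a * b ^ 2 ∧ cardFactors a ≤ K) ∧ n ≤ (K + 1) * g n)

open ArithmeticFunction in
lemma twoPowDvdOrFewFactors_sigma_one : TwoPowDvdOrFewFactors (fun n => sigma 1 n) := by
  intro K n hn
  obtain ⟨a, b, rfl, ha⟩ := Nat.sq_mul_squarefree n
  have hb : b ≠ 0 := by rintro rfl; simp at hn
  rcases Nat.lt_or_ge K (cardFactors a) with h | h
  · left
    rw [mul_comm]
    exact two_pow_dvd_sigma_one hb ha h
  · exact Or.inr ⟨⟨a, b, mul_comm _ _, h⟩,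
      (le_sigma_one _).trans (Nat.le_mul_of_pos_left _ K.succ_pos)⟩

open ArithmeticFunction in
lemma twoPowDvdOrFewFactors_totient : TwoPowDvdOrFewFactors Nat.totient := by
  intro K n hn
  rcases Nat.lt_or_ge K n.primeFactors.card with h | h
  · exact Or.inl (two_pow_dvd_totient (by omega) h)
  · refine Or.inr ⟨?_, (le_card_primeFactors_succ_mul_totient n).trans
      (Nat.mul_le_mul_right _ (Nat.succ_le_succ h))⟩
    obtain ⟨a, b, rfl, ha⟩ := Nat.sq_mul_squarefree n
    refine ⟨a, b, mul_comm _ _, ?_⟩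
    rw [← (cardDistinctFactors_eq_cardFactors_iff_squarefree ha.ne_zero).2 ha,
      cardDistinctFactors_eq_card_primeFactors]
    exact (Finset.card_le_card
      (Nat.primeFactors_mono (dvd_mul_left a _) (by omega))).trans h

/-! ### Sparsity of the values of g -/

/-- The scale `2 ^ 2 ^ (8 i)` along which value counts are estimated. -/
def scale (i : ℕ) : ℕ := 2 ^ 2 ^ (8 * i)

lemma half_pow_le_sqrt_log_scale (i : ℕ) : (2 : ℝ) ^ (4 * i) / 2 ≤ √(Real.log (scale i)) := by
  refine Real.le_sqrt_of_sq_le ?_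
  rw [scale, Nat.cast_pow, Real.log_pow]
  push_cast
  rw [div_pow, ← pow_mul, show 4 * i * 2 = 8 * i by ring]
  have := Real.log_two_gt_d9
  have : (0 : ℝ) < 2 ^ (8 * i) := by positivity
  nlinarith

lemma exists_card_values_le {g : ℕ → ℕ} (hg : TwoPowDvdOrFewFactors g) :
    ∃ C : ℝ, 0 ≤ C ∧ ∀ i : ℕ, 1 ≤ i → ∀ S ⊆ Icc 1 (2 * scale i),
      (∀ m ∈ S, ∃ n, 1 ≤ n ∧ g n = m) →
      (S.card : ℝ) ≤ C * (i + 1) * (scale i / 2 ^ i) := by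
  obtain ⟨C, hC, hcount⟩ := exists_card_cardFactors_squarefree_part_le
  refine ⟨2 + 4 * C, by positivity, fun i hi S hS hval => ?_⟩
  classical
  set X := scale i with hX
  -- A value `g n ≤ 2 * X` not divisible by `2 ^ i` comes from some `n ≤ (i + 1) * g n ≤ N`; such
  -- values are counted through their preimages in `B`.
  set N := (i + 1) * (2 * X) with hN
  set A := (Ioc 0 (2 * X)).filter (2 ^ i ∣ ·) with hA
  set B := (Icc 1 N).filter
    (fun n => ∃ a b, n = a * b ^ 2 ∧ ArithmeticFunction.cardFactors a ≤ i) with hB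
  have hXbig : 9 ≤ X := by
    have h1 : 2 ^ (8 * 1) ≤ 2 ^ (8 * i) := Nat.pow_le_pow_right (by norm_num) (by omega)
    have h2 : 2 ^ 4 ≤ X := Nat.pow_le_pow_right (by norm_num) (le_trans (by norm_num) h1)
    omega
  have hXN : X ≤ N := by rw [hN]; nlinarith
  have hsub : S ⊆ A ∪ B.image g := by
    intro m hm
    have hm' := mem_Icc.1 (hS hm)
    obtain ⟨n, hn, rfl⟩ := hval m hm
    rcases hg i n hn with h | ⟨h, hle⟩
    · exact mem_union_left _ (mem_filter.2 ⟨mem_Ioc.2 hm', h⟩)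
    · refine mem_union_right _ (mem_image_of_mem g (mem_filter.2 ⟨mem_Icc.2 ⟨hn, ?_⟩, h⟩))
      exact hle.trans (Nat.mul_le_mul_left _ hm'.2)
  have hcard : (S.card : ℝ) ≤ A.card + B.card := by
    have h1 := (Finset.card_le_card hsub).trans (Finset.card_union_le _ _)
    have h2 := Finset.card_image_le (s := B) (f := g)
    exact_mod_cast h1.trans (Nat.add_le_add_left h2 _)
  have hAcard : (A.card : ℝ) ≤ 2 * (X / 2 ^ i) := by
    rw [hA, Nat.Ioc_filter_dvd_card_eq_div]
    refine Nat.cast_div_le.trans_eq ?_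
    push_cast
    ring
  have hBcard := hcount i N (hXbig.trans hXN) B (Finset.filter_subset _ _)
    fun n hn => (mem_filter.1 hn).2
  have hsqrt : (2 : ℝ) ^ (4 * i) / 2 ≤ √(Real.log N) :=
    (half_pow_le_sqrt_log_scale i).trans (Real.sqrt_le_sqrt (log_natCast_mono hXN))
  have hB2 : C * 2 ^ i * (N / √(Real.log N)) ≤ 4 * C * (i + 1) * (X / 2 ^ i) := by
    calc C * 2 ^ i * (N / √(Real.log N)) ≤ C * 2 ^ i * (N / (2 ^ (4 * i) / 2)) := by gcongr
      _ = 4 * C * (i + 1) * (X / 2 ^ i) * (1 / 2 ^ (2 * i)) := by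
          rw [hN]
          push_cast
          have : (2 : ℝ) ^ (4 * i) = 2 ^ i * 2 ^ i * 2 ^ (2 * i) := by
            rw [← pow_add, ← pow_add]
            congr 1
            ring
          rw [this]
          field_simp
          ring
      _ ≤ 4 * C * (i + 1) * (X / 2 ^ i) := by
          refine mul_le_of_le_one_right (by positivity) ?_
          rw [div_le_one (by positivity)]
          exact one_le_pow₀ (by norm_num)
  have hXi : (0 : ℝ) ≤ X / 2 ^ i := by positivity
  have hi0 : (0 : ℝ) ≤ i := by positivity
  nlinarith [mul_nonneg hXi hi0]

/-! ### Tails of a rational series and their average over gaps -/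

lemma hasSum_ite_mem (s : Finset ℕ) (u : ℕ → ℝ) :
    HasSum (fun n => if n ∈ s then u n else 0) (∑ n ∈ s, u n) := by
  have h : ∑ n ∈ s, u n = ∑ n ∈ s, (if n ∈ s then u n else 0) :=
    Finset.sum_congr rfl fun n hn => (if_pos hn).symm
  rw [h]
  exact hasSum_sum_of_ne_finset_zero fun n hn => if_neg hn

/-- If `∑ F n / t ^ γ n` is rational, the normalised tails are bounded away from zero. -/
lemma exists_le_tail_of_not_irrational {F γ : ℕ → ℕ} {t : ℕ} (ht : 2 ≤ t)
    (hs : Summable fun n => (F n : ℝ) / (t : ℝ) ^ γ n)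
    (hF : {n | F n ≠ 0}.Infinite) (hγ : ∀ N, {n | γ n ≤ N}.Finite)
    (hirr : ¬ Irrational (∑' n, (F n : ℝ) / (t : ℝ) ^ γ n)) :
    ∃ q : ℕ, 0 < q ∧ ∀ N : ℕ,
      1 ≤ q * ∑' n, (if N < γ n then (t : ℝ) ^ N * ((F n : ℝ) / (t : ℝ) ^ γ n) else 0) := by
  rw [Irrational, not_not] at hirr
  obtain ⟨s, hsum⟩ := hirr
  refine ⟨s.den, s.den_pos, fun N => ?_⟩
  have ht0 : (t : ℝ) ≠ 0 := by positivity
  set T : ℕ → ℝ := fun n => (t : ℝ) ^ N * ((F n : ℝ) / (t : ℝ) ^ γ n) with hT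
  have hT0 : ∀ n, 0 ≤ T n := fun n => by positivity
  have hTs : Summable T := hs.mul_left _
  have htail : Summable fun n => if N < γ n then T n else 0 :=
    Summable.of_nonneg_of_le (fun n => by split_ifs <;> simp [hT0])
      (fun n => by split_ifs <;> simp [hT0]) hTs
  have hsplit : ∑' n, T n = ∑ n ∈ (hγ N).toFinset, T n + ∑' n, (if N < γ n then T n else 0) := by
    have h1 : HasSum (fun n => if n ∈ (hγ N).toFinset then T n else 0)
        (∑ n ∈ (hγ N).toFinset, T n) := hasSum_ite_mem _ T
    have h2 := h1.add htail.hasSum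
    rw [← h2.tsum_eq]
    refine tsum_congr fun n => ?_
    by_cases h : γ n ≤ N
    · simp [h]
    · simp [h, not_le.1 h]
  have hint : ∑ n ∈ (hγ N).toFinset, T n =
      ((∑ n ∈ (hγ N).toFinset, (t ^ (N - γ n) * F n : ℕ) : ℕ) : ℝ) := by
    push_cast
    refine Finset.sum_congr rfl fun n hn => ?_
    have h : γ n ≤ N := by simpa using hn
    rw [hT, pow_sub₀ _ ht0 h]
    field_simp
  have htot : (s.den : ℝ) * ∑' n, T n = ((t ^ N * s.num : ℤ) : ℝ) := by
    rw [tsum_mul_left, ← hsum]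
    have : (s : ℝ) = s.num / s.den := Rat.cast_def s
    have hd : (s.den : ℝ) ≠ 0 := by exact_mod_cast s.den_ne_zero
    rw [this]
    push_cast
    field_simp
  -- Infinitely many `F n` are nonzero and only finitely many `n` have `γ n ≤ N`, so the tail has a
  -- positive term.
  have hpos : 0 < (s.den : ℝ) * ∑' n, (if N < γ n then T n else 0) := by
    obtain ⟨n, hn, hn'⟩ := (hF.sdiff (hγ N)).nonempty
    have hlt : N < γ n := not_le.1 hn'
    refine mul_pos (by exact_mod_cast s.den_pos)
      (htail.tsum_pos (fun n => by split_ifs <;> simp [hT0]) n ?_)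
    rw [if_pos hlt]
    have : (0 : ℝ) < F n := by exact_mod_cast Nat.pos_of_ne_zero hn
    have : (0 : ℝ) < t := by positivity
    positivity
  have heq : (s.den : ℝ) * ∑' n, (if N < γ n then T n else 0) =
      ((t ^ N * s.num - s.den * (∑ n ∈ (hγ N).toFinset, (t ^ (N - γ n) * F n : ℕ) : ℕ) : ℤ) : ℝ) := by
    rw [Int.cast_sub, ← htot, hsplit, hint]
    push_cast
    ring
  rw [heq] at hpos ⊢
  exact_mod_cast hpos

lemma sum_range_pow_le {t : ℕ} (ht : 2 ≤ t) (M : ℕ) :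
    ∑ N ∈ range M, (t : ℝ) ^ N ≤ (t : ℝ) ^ M := by
  have := Nat.geomSum_lt (m := t) (n := M) (s := range M) ht (by simp)
  exact_mod_cast this.le

/-- Averaging the tails over the starting points of gaps in the set of exponents. -/
lemma sum_tail_le {F γ : ℕ → ℕ} {t : ℕ} (ht : 2 ≤ t) {r : ℝ} (hr0 : 0 ≤ r) (hr : r ^ 2 = 1 / 2)
    (hs : Summable fun n => (F n : ℝ) / (t : ℝ) ^ γ n)
    (hsr : Summable fun n => (F n : ℝ) * r ^ γ n) {X L Y : ℕ}
    (hY : ∀ n, γ n ≤ 2 * X → n < Y) {G : Finset ℕ} (hGX : G ⊆ range X)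
    (hG : ∀ N ∈ G, ∀ n, γ n ≤ N ∨ N + L < γ n) :
    ∑ N ∈ G, ∑' n, (if N < γ n then (t : ℝ) ^ N * ((F n : ℝ) / (t : ℝ) ^ γ n) else 0) ≤
      (∑ n ∈ range Y, (F n : ℝ)) / 2 ^ L + ∑' n, (F n : ℝ) * r ^ γ n := by
  have ht0 : (0 : ℝ) < t := by positivity
  have ht2 : (2 : ℝ) ≤ t := by exact_mod_cast ht
  have hr1 : r ≤ 1 := by nlinarith
  have hsum : ∀ N ∈ G, Summable fun n =>
      (if N < γ n then (t : ℝ) ^ N * ((F n : ℝ) / (t : ℝ) ^ γ n) else 0) := fun N _ =>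
    Summable.of_nonneg_of_le (fun n => by positivity)
      (fun n => by split_ifs; exacts [le_rfl, by positivity]) (hs.mul_left ((t : ℝ) ^ N))
  rw [← Summable.tsum_finsetSum hsum]
  have h1 : HasSum (fun n => if n ∈ range Y then (F n : ℝ) / 2 ^ L else 0)
      ((∑ n ∈ range Y, (F n : ℝ)) / 2 ^ L) := by
    rw [Finset.sum_div]
    exact hasSum_ite_mem _ fun n => (F n : ℝ) / 2 ^ L
  have h2 := h1.add hsr.hasSum
  rw [← h2.tsum_eq]
  refine Summable.tsum_le_tsum (fun n => ?_) (summable_sum hsum) h2.summable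
  have hstep : ∀ M : ℕ, (∀ N ∈ G, N < γ n → N < M) →
      ∑ N ∈ G, (if N < γ n then (t : ℝ) ^ N * ((F n : ℝ) / (t : ℝ) ^ γ n) else 0) ≤
        (t : ℝ) ^ M * ((F n : ℝ) / (t : ℝ) ^ γ n) := by
    intro M hM
    rw [← Finset.sum_filter, ← Finset.sum_mul]
    refine mul_le_mul_of_nonneg_right (le_trans ?_ (sum_range_pow_le ht M)) (by positivity)
    refine Finset.sum_le_sum_of_subset_of_nonneg (fun N hN => ?_) fun _ _ _ => by positivity
    rw [mem_filter] at hN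
    exact mem_range.2 (hM N hN.1 hN.2)
  rcases le_or_gt (γ n) (2 * X) with hle | hgt
  · rw [if_pos (mem_range.2 (hY n hle))]
    refine le_add_of_le_of_nonneg ?_ (by positivity)
    -- Any `N ∈ G` below `γ n` lies below `γ n - L`, so the geometric sum gains `t ^ (-L)`; if `γ n
    -- < L` there is no such `N`.
    rcases le_or_gt L (γ n) with hL | hL
    · refine (hstep (γ n - L) fun N hN hlt => ?_).trans ?_
      · rcases hG N hN n with h | h <;> omega
      · rw [pow_sub₀ _ ht0.ne' hL]
        calc _ = (F n : ℝ) / (t : ℝ) ^ L := by field_simp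
          _ ≤ _ := by gcongr
    · refine le_trans (le_of_eq (Finset.sum_eq_zero fun N hN => if_neg ?_)) (by positivity)
      rcases hG N hN n with h | h <;> omega
  -- Here `2 * (γ n - X) ≥ γ n`, so `2 ^ (-(γ n - X)) = r ^ (2 * (γ n - X)) ≤ r ^ γ n`, a bound
  -- independent of `X`.
  · refine le_add_of_nonneg_of_le (by positivity) ?_
    refine (hstep X fun N hN _ => mem_range.1 (hGX hN)).trans ?_
    have h3 : (t : ℝ) ^ γ n = (t : ℝ) ^ X * (t : ℝ) ^ (γ n - X) := by
      rw [← pow_add]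
      congr 1
      omega
    calc (t : ℝ) ^ X * ((F n : ℝ) / (t : ℝ) ^ γ n) = (F n : ℝ) / (t : ℝ) ^ (γ n - X) := by
          rw [h3]
          field_simp
      _ ≤ (F n : ℝ) / 2 ^ (γ n - X) := by gcongr
      _ = (F n : ℝ) * r ^ (2 * (γ n - X)) := by
          rw [pow_mul, hr, one_div, inv_pow, div_eq_mul_inv]
      _ ≤ (F n : ℝ) * r ^ γ n := by
          refine mul_le_mul_of_nonneg_left (pow_le_pow_of_le_one hr0 hr1 (by omega))
            (by positivity)

/-! ### Convergence and choice of parameters -/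

lemma sq_succ_le_four_mul_two_pow (k : ℕ) : (k + 1) ^ 2 ≤ 4 * 2 ^ k := by
  induction k with
  | zero => norm_num
  | succ k ih =>
    rcases Nat.lt_or_ge k 2 with h | h
    · interval_cases k <;> norm_num
    · rw [pow_succ 2 k]
      nlinarith

lemma le_four_mul_sq_of_le_log_mul {m v : ℕ} (h : m ≤ (Nat.log 2 m + 1) * v) :
    m ≤ 4 * v ^ 2 := by
  rcases Nat.eq_zero_or_pos m with rfl | hm
  · simp
  have h1 := sq_succ_le_four_mul_two_pow (Nat.log 2 m)
  have h2 := Nat.pow_log_le_self 2 hm.ne'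
  have h3 : m * m ≤ m * (4 * v ^ 2) := by
    calc m * m ≤ ((Nat.log 2 m + 1) * v) * ((Nat.log 2 m + 1) * v) := Nat.mul_le_mul h h
      _ = (Nat.log 2 m + 1) ^ 2 * v ^ 2 := by ring
      _ ≤ (4 * m) * v ^ 2 := Nat.mul_le_mul_right _ (by omega)
      _ = _ := by ring
  exact le_of_mul_le_mul_left h3 hm

/-- A bootstrap: the crude `m ≤ 4 * v ^ 2` bounds `Nat.log 2 m` by `2 * E + 4`, which is fed back
into the hypothesis. -/
lemma le_of_le_log_mul_scale {m v i : ℕ} (h : m ≤ (Nat.log 2 m + 1) * v)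
    (hv : v ≤ 2 * scale i) : m ≤ 14 * scale i * 2 ^ (8 * i) := by
  set E := 2 ^ (8 * i) with hE
  have hE1 : 1 ≤ E := Nat.one_le_two_pow
  have h1 : m ≤ 2 ^ (2 * E + 4) := by
    calc m ≤ 4 * v ^ 2 := le_four_mul_sq_of_le_log_mul h
      _ ≤ 4 * (2 * scale i) ^ 2 := Nat.mul_le_mul_left _ (Nat.pow_le_pow_left hv 2)
      _ = 2 ^ (2 * E + 4) := by rw [scale, ← hE]; ring
  have h2 : Nat.log 2 m ≤ 2 * E + 4 := by
    have := Nat.log_mono_right (b := 2) h1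
    rwa [Nat.log_pow one_lt_two] at this
  calc m ≤ (Nat.log 2 m + 1) * v := h
    _ ≤ (7 * E) * (2 * scale i) := Nat.mul_le_mul (by omega) hv
    _ = _ := by ring

/-- Here `f m` is at most `C * m ^ (e + 1)`, while `m ≤ 4 * g m ^ 2` makes `m ^ (e + 3) * r ^ g m`
bounded; the terms are O(1 / m²). -/
lemma summable_mul_pow_of_le {f g : ℕ → ℕ} {C : ℝ} {e : ℕ}
    (hf : ∀ N : ℕ, 1 ≤ N → ∑ n ∈ Icc 1 N, (f n : ℝ) ≤ C * (N * (1 + Real.log N) ^ e))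
    (hC : 0 ≤ C) (hg : ∀ n, n ≤ (Nat.log 2 n + 1) * g n) {r : ℝ} (hr0 : 0 ≤ r) (hr1 : r < 1) :
    Summable fun n => (f (n + 1) : ℝ) * r ^ g (n + 1) := by
  obtain ⟨B, hB⟩ := (tendsto_pow_const_mul_const_pow_of_lt_one (2 * (e + 3)) hr0
    hr1).bddAbove_range
  have hB' : ∀ v : ℕ, (v : ℝ) ^ (2 * (e + 3)) * r ^ v ≤ B := fun v => hB ⟨v, rfl⟩
  have hsq : Summable fun n : ℕ => C * B * 4 ^ (e + 3) * (1 / ((n + 1 : ℕ) : ℝ) ^ 2) :=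
    ((summable_nat_add_iff 1).2 (Real.summable_one_div_nat_pow.2 one_lt_two)).mul_left _
  refine Summable.of_nonneg_of_le (fun n => by positivity) (fun n => ?_) hsq
  set m := n + 1 with hm
  have hm1 : 1 ≤ m := by omega
  have hmR : (1 : ℝ) ≤ m := by exact_mod_cast hm1
  have hm0 : (0 : ℝ) < m := by linarith
  have h1 : (f m : ℝ) ≤ C * (m : ℝ) ^ (e + 1) := by
    have h2 : (f m : ℝ) ≤ ∑ n ∈ Icc 1 m, (f n : ℝ) :=
      Finset.single_le_sum (f := fun n => (f n : ℝ)) (fun _ _ => by positivity)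
        (mem_Icc.2 ⟨hm1, le_rfl⟩)
    refine (h2.trans (hf m hm1)).trans (mul_le_mul_of_nonneg_left ?_ hC)
    rw [pow_succ']
    have h3 := Real.log_le_sub_one_of_pos hm0
    have h4 := one_add_log_natCast_pos m
    gcongr
    linarith
  have h2 : (m : ℝ) ^ (e + 3) * r ^ g m ≤ 4 ^ (e + 3) * B := by
    have h3 : (m : ℝ) ≤ 4 * (g m : ℝ) ^ 2 := by
      exact_mod_cast le_four_mul_sq_of_le_log_mul (hg m)
    calc (m : ℝ) ^ (e + 3) * r ^ g m ≤ (4 * (g m : ℝ) ^ 2) ^ (e + 3) * r ^ g m := by gcongr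
      _ = 4 ^ (e + 3) * ((g m : ℝ) ^ (2 * (e + 3)) * r ^ g m) := by
          rw [mul_pow, ← pow_mul]
          ring
      _ ≤ _ := by gcongr; exact hB' _
  rw [mul_one_div, le_div_iff₀ (by positivity)]
  calc (f m : ℝ) * r ^ g m * (m : ℝ) ^ 2 ≤ C * (m : ℝ) ^ (e + 1) * r ^ g m * (m : ℝ) ^ 2 := by
        gcongr
    _ = C * ((m : ℝ) ^ (e + 3) * r ^ g m) := by ring
    _ ≤ C * (4 ^ (e + 3) * B) := by gcongr
    _ = _ := by ring

lemma sum_Icc_le_scale {f : ℕ → ℕ} {C : ℝ} {e : ℕ} (hC : 0 ≤ C)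
    (hf : ∀ N : ℕ, 1 ≤ N → ∑ n ∈ Icc 1 N, (f n : ℝ) ≤ C * (N * (1 + Real.log N) ^ e)) (i : ℕ) :
    ∑ n ∈ Icc 1 (14 * scale i * 2 ^ (8 * i)), (f n : ℝ) ≤
      C * 14 * 7 ^ e * (scale i * ((2 : ℝ) ^ (8 * i)) ^ (e + 1)) := by
  set E := 2 ^ (8 * i) with hE
  have hE1 : 1 ≤ E := Nat.one_le_two_pow
  have hX : 0 < scale i := by rw [scale]; positivity
  set Y := 14 * scale i * E with hY
  have hlog : 1 + Real.log Y ≤ 7 * (2 : ℝ) ^ (8 * i) := by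
    have h1 : Y ≤ 2 ^ (6 * E) := by
      have h2 : E ≤ 2 ^ E := Nat.lt_two_pow_self.le
      calc Y ≤ 2 ^ (4 * E) * scale i * 2 ^ E := by
            refine Nat.mul_le_mul (Nat.mul_le_mul_right _ ?_) h2
            exact le_trans (by norm_num) (Nat.pow_le_pow_right (n := 2) (by norm_num)
              (by omega : 4 ≤ 4 * E))
        _ = 2 ^ (6 * E) := by rw [scale, ← hE]; ring
    have h3 := log_natCast_mono h1
    rw [Nat.cast_pow, Real.log_pow] at h3
    have h4 := Real.log_two_lt_d9
    have h5 : ((E : ℕ) : ℝ) = (2 : ℝ) ^ (8 * i) := by rw [hE]; push_cast; rfl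
    rw [← h5]
    have h6 : (1 : ℝ) ≤ E := by exact_mod_cast hE1
    push_cast at h3
    nlinarith
  have h7 := one_add_log_natCast_pos Y
  refine (hf Y (Nat.mul_pos (Nat.mul_pos (by norm_num) hX) hE1)).trans ?_
  calc C * (Y * (1 + Real.log Y) ^ e) ≤ C * (Y * (7 * (2 : ℝ) ^ (8 * i)) ^ e) := by gcongr
    _ = _ := by
        rw [hY, hE]
        push_cast
        rw [mul_pow]
        ring

lemma exists_sq_succ_mul_lt_two_pow (D : ℝ) :
    ∃ i : ℕ, 1 ≤ i ∧ D * ((i : ℝ) + 1) ^ 2 < 2 ^ i := by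
  have h := tendsto_pow_const_mul_const_pow_of_lt_one 2 (r := 1 / 2) (by norm_num) (by norm_num)
  have h1 := ((Filter.tendsto_add_atTop_iff_nat 1).2 h).const_mul (2 * D)
  rw [mul_zero] at h1
  obtain ⟨i, hi, hi1⟩ := ((h1.eventually_lt_const zero_lt_one).and
    (Filter.eventually_ge_atTop 1)).exists
  refine ⟨i, hi1, ?_⟩
  push_cast at hi
  rw [one_div, inv_pow, pow_succ (2 : ℝ) i] at hi
  have h2 : (0 : ℝ) < 2 ^ i := by positivity
  have h3 : 2 * D * (((i : ℝ) + 1) ^ 2 * (2 ^ i * 2)⁻¹) = D * ((i : ℝ) + 1) ^ 2 / 2 ^ i := by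
    field_simp
  rw [h3, div_lt_one h2] at hi
  exact hi

/-- With `L = 8 * i * (e + 2)`, the conditions say that gaps fit below the scale, that starting
points too close to a value number at most half the scale, and that `2 ^ i` exceeds the constant of
the final contradiction. -/
lemma exists_scale_index (e : ℕ) {V W : ℝ} (hV : 0 ≤ V) (hW : 0 ≤ W) :
    ∃ i : ℕ, 1 ≤ i ∧ 8 * i * (e + 2) ≤ scale i ∧
      V * (i + 1) * (8 * i * (e + 2) : ℕ) * 2 ≤ 2 ^ i ∧ W < 2 ^ i := by
  obtain ⟨i, hi, hD⟩ := exists_sq_succ_mul_lt_two_pow (16 * (e + 2) * (V + 1) + W)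
  have hi0 : (0 : ℝ) ≤ i := by positivity
  have hu : (1 : ℝ) ≤ ((i : ℝ) + 1) ^ 2 := one_le_pow₀ (by linarith)
  have hc : (0 : ℝ) ≤ 16 * (e + 2) * (V + 1) := by positivity
  have hii : (i : ℝ) * (i + 1) ≤ (i + 1) ^ 2 := by nlinarith
  have hW1 : W ≤ W * ((i : ℝ) + 1) ^ 2 := le_mul_of_one_le_right hW hu
  have hc1 := mul_nonneg hc (by positivity : (0 : ℝ) ≤ ((i : ℝ) + 1) ^ 2)
  have hmain : 16 * (e + 2) * (V + 1) * ((i : ℝ) * (i + 1)) ≤ 2 ^ i := by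
    have := mul_le_mul_of_nonneg_left hii hc
    linarith
  refine ⟨i, hi, ?_, ?_, by linarith⟩
  · have h1 : ((8 * i * (e + 2) : ℕ) : ℝ) ≤ 2 ^ i := by
      refine le_trans ?_ hmain
      push_cast
      have h2 : (1 : ℝ) ≤ 2 * (V + 1) * (i + 1) := by nlinarith [mul_nonneg hV hi0]
      calc (8 * i * (e + 2) : ℝ) ≤ 8 * i * (e + 2) * (2 * (V + 1) * (i + 1)) :=
            le_mul_of_one_le_right (by positivity) h2
        _ = _ := by ring
    have h2 : 8 * i * (e + 2) ≤ 2 ^ i := by exact_mod_cast h1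
    refine h2.trans (Nat.pow_le_pow_right (by norm_num) ?_)
    exact le_trans (by omega) (Nat.lt_two_pow_self (n := 8 * i)).le
  · refine le_trans ?_ hmain
    push_cast
    have h1 : (0 : ℝ) ≤ 16 * (e + 2) * (i * (i + 1)) := by positivity
    calc V * (i + 1) * (8 * i * (e + 2)) * 2 = 16 * (e + 2) * (i * (i + 1)) * V := by ring
      _ ≤ 16 * (e + 2) * (i * (i + 1)) * (V + 1) := by gcongr; linarith
      _ = _ := by ring

/-- Most starting points below the scale are followed by a gap of length `L`. -/
lemma exists_gap_starts {γ : ℕ → ℕ} {i L : ℕ} {V : ℝ} (hL : L ≤ scale i)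
    (hV : ∀ S ⊆ Icc 1 (2 * scale i), (∀ m ∈ S, ∃ n, γ n = m) → (S.card : ℝ) ≤ V) :
    ∃ G ⊆ range (scale i), (∀ N ∈ G, ∀ n, γ n ≤ N ∨ N + L < γ n) ∧
      (scale i : ℝ) - V * L ≤ G.card := by
  classical
  set X := scale i
  set S := (Icc 1 (2 * X)).filter (fun m => ∃ n, γ n = m) with hS
  -- A bad start is `v - j` with `v` a value and `1 ≤ j ≤ L`; since `L ≤ X`, such `v` is at most `2
  -- * X`.
  set B := (S ×ˢ Icc 1 L).image (fun x => x.1 - x.2) with hB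
  have hSV := hV S (Finset.filter_subset _ _) fun m hm => (mem_filter.1 hm).2
  refine ⟨range X \ B, Finset.sdiff_subset, fun N hN n => ?_, ?_⟩
  · by_contra! hcon
    rw [mem_sdiff, mem_range] at hN
    refine hN.2 (mem_image.2 ⟨(γ n, γ n - N), mem_product.2 ⟨mem_filter.2 ⟨?_, n, rfl⟩, ?_⟩, ?_⟩)
    · exact mem_Icc.2 ⟨by omega, by omega⟩
    · exact mem_Icc.2 ⟨by omega, by omega⟩
    · simp only
      omega
  · have h1 := Finset.le_card_sdiff B (range X)
    rw [card_range] at h1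
    have h2 : B.card ≤ S.card * L := by
      refine Finset.card_image_le.trans ?_
      rw [card_product, Nat.card_Icc, Nat.add_sub_cancel]
    have h3 : (X : ℝ) ≤ (range X \ B).card + S.card * L := by
      exact_mod_cast (by omega : X ≤ (range X \ B).card + S.card * L)
    have h4 : (S.card : ℝ) * L ≤ V * L := by gcongr
    linarith

/-! ### The irrationality argument -/

lemma irrationalSeries_of_le {f g : ℕ → ℕ} {t : ℕ} (ht : 2 ≤ t)
    (hf0 : {n : ℕ | 1 ≤ n ∧ f n ≠ 0}.Infinite) {C : ℝ} {e : ℕ} (hC : 0 ≤ C)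
    (hf : ∀ N : ℕ, 1 ≤ N → ∑ n ∈ Icc 1 N, (f n : ℝ) ≤ C * (N * (1 + Real.log N) ^ e))
    (hg : ∀ n, n ≤ (Nat.log 2 n + 1) * g n) (hval : TwoPowDvdOrFewFactors g) :
    IrrationalSeries f g t := by
  set F : ℕ → ℕ := fun n => f (n + 1) with hFdef
  set γ : ℕ → ℕ := fun n => g (n + 1) with hγdef
  have ht2 : (2 : ℝ) ≤ t := by exact_mod_cast ht
  have hs : Summable fun n => (F n : ℝ) / (t : ℝ) ^ γ n := by
    have := summable_mul_pow_of_le hf hC hg (r := (t : ℝ)⁻¹) (by positivity)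
      (inv_lt_one_of_one_lt₀ (by linarith))
    simpa only [inv_pow, ← div_eq_mul_inv] using this
  refine ⟨_, hs.hasSum, ?_⟩
  by_contra hirr
  have hF : {n | F n ≠ 0}.Infinite := by
    intro hfin
    refine hf0 ((hfin.image (· + 1)).subset ?_)
    rintro n ⟨hn, hfn⟩
    exact ⟨n - 1, by simpa [hFdef, Nat.sub_add_cancel hn] using hfn, Nat.sub_add_cancel hn⟩
  have hγ : ∀ N, {n | γ n ≤ N}.Finite := by
    intro N
    refine (Set.finite_le_nat (4 * N ^ 2)).subset fun n hn => ?_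
    have h1 := le_four_mul_sq_of_le_log_mul (hg (n + 1))
    have h2 : γ n ^ 2 ≤ N ^ 2 := Nat.pow_le_pow_left hn 2
    simp only [Set.mem_ofPred_eq, hγdef] at h2 ⊢
    omega
  obtain ⟨q, hq, htail⟩ := exists_le_tail_of_not_irrational ht hs hF hγ hirr
  obtain ⟨Cv, hCv, hcount⟩ := exists_card_values_le hval
  set r : ℝ := √(1 / 2) with hrdef
  have hr0 : 0 ≤ r := Real.sqrt_nonneg _
  have hr2 : r ^ 2 = 1 / 2 := Real.sq_sqrt (by norm_num)
  have hr1 : r < 1 := by nlinarith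
  have hsr : Summable fun n => (F n : ℝ) * r ^ γ n := summable_mul_pow_of_le hf hC hg hr0 hr1
  set Z := ∑' n, (F n : ℝ) * r ^ γ n with hZ
  have hZ0 : 0 ≤ Z := tsum_nonneg fun n => by positivity
  set C' := C * 14 * 7 ^ e with hC'
  have hC'0 : 0 ≤ C' := by positivity
  obtain ⟨i, hi, hLX, hbad, hsmall⟩ := exists_scale_index e hCv
    (by positivity : 0 ≤ 2 * q * (C' + Z))
  set X := scale i with hX
  set L := 8 * i * (e + 2) with hL
  have hq0 : (0 : ℝ) < q := by exact_mod_cast hq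
  have hP : (0 : ℝ) < 2 ^ i := by positivity
  have hEX : 2 ^ (8 * i) ≤ X := Nat.lt_two_pow_self.le
  have hiE : 2 ^ i ≤ 2 ^ (8 * i) := Nat.pow_le_pow_right (by norm_num) (by omega)
  have hX0 : (0 : ℝ) < X := by
    have : 0 < X := by rw [hX, scale]; positivity
    exact_mod_cast this
  obtain ⟨G, hGX, hG, hGcard⟩ := exists_gap_starts (γ := γ) (i := i) hLX
    (V := Cv * (i + 1) * (X / 2 ^ i)) fun S hS hm => hcount i hi S hS fun m hmS => by
      obtain ⟨n, hn⟩ := hm m hmS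
      exact ⟨n + 1, by omega, hn⟩
  have hhalf : (X : ℝ) / 2 ≤ G.card := by
    have h1 : Cv * (i + 1) * (X / 2 ^ i) * L ≤ (X : ℝ) / 2 := by
      calc Cv * (i + 1) * (X / 2 ^ i) * L = (Cv * (i + 1) * L * 2) * (X / 2 ^ i / 2) := by ring
        _ ≤ 2 ^ i * (X / 2 ^ i / 2) := by gcongr
        _ = _ := by field_simp
    rw [← hX] at hGcard
    linarith
  have hupper := sum_tail_le ht hr0 hr2 hs hsr (X := X) (L := L)
    (Y := 14 * scale i * 2 ^ (8 * i))
    (fun n hn => le_of_le_log_mul_scale (hg (n + 1)) hn) hGX hG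
  have hA : (∑ n ∈ range (14 * scale i * 2 ^ (8 * i)), (F n : ℝ)) / 2 ^ L ≤ C' * X / 2 ^ i := by
    have h1 : ∑ n ∈ range (14 * scale i * 2 ^ (8 * i)), (F n : ℝ) =
        ∑ n ∈ Icc 1 (14 * scale i * 2 ^ (8 * i)), (f n : ℝ) := by
      rw [← Finset.Ico_add_one_right_eq_Icc, Finset.sum_Ico_eq_sum_range, Nat.add_sub_cancel]
      exact Finset.sum_congr rfl fun n _ => by rw [add_comm 1 n]
    have h2 := sum_Icc_le_scale hC hf i
    rw [← h1] at h2
    -- The sum of `f` costs `(2 ^ (8 * i)) ^ (e + 1)`; the choice of `L` cancels this and leaves a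
    -- spare factor `2 ^ (8 * i)`.
    have h3 : (2 : ℝ) ^ L = ((2 : ℝ) ^ (8 * i)) ^ (e + 1) * 2 ^ (8 * i) := by
      rw [← pow_succ, ← pow_mul]
    calc _ ≤ C' * (X * ((2 : ℝ) ^ (8 * i)) ^ (e + 1)) / 2 ^ L := by gcongr
      _ = C' * X / 2 ^ (8 * i) := by rw [h3]; field_simp
      _ ≤ _ := by
          have : (2 : ℝ) ^ i ≤ 2 ^ (8 * i) := by exact_mod_cast hiE
          gcongr
  have hlower : (G.card : ℝ) / q ≤
      ∑ N ∈ G, ∑' n, (if N < γ n then (t : ℝ) ^ N * ((F n : ℝ) / (t : ℝ) ^ γ n) else 0) := by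
    rw [div_eq_mul_one_div, ← nsmul_eq_mul]
    refine Finset.card_nsmul_le_sum _ _ _ fun N _ => ?_
    rw [div_le_iff₀' hq0]
    exact htail N
  have hXi : (2 : ℝ) ^ i ≤ X := by exact_mod_cast hiE.trans hEX
  have hZX : Z ≤ Z * X / 2 ^ i := by
    rw [le_div_iff₀ hP]
    gcongr
  have hfin : (X : ℝ) / 2 / q ≤ (C' + Z) * X / 2 ^ i := by
    calc (X : ℝ) / 2 / q ≤ G.card / q := by gcongr
      _ ≤ _ := hlower
      _ ≤ _ := hupper
      _ ≤ C' * X / 2 ^ i + Z * X / 2 ^ i := add_le_add hA hZX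
      _ = _ := by ring
  -- After cancelling `X`, this reads `2 ^ i ≤ 2 * q * (C' + Z)`, contrary to `hsmall`.
  rw [div_div, div_le_div_iff₀ (by positivity) hP] at hfin
  nlinarith

/-- Allowing `δ = 0` covers `d(n) ^ 0`, whose exponent is `2 ^ 0 - 1 = 0`. -/
lemma irrationalSigmaPhiSeries_of_sumIsBigOLogPow {f : ℕ → ℕ}
    (hf : {n : ℕ | 1 ≤ n ∧ f n ≠ 0}.Infinite) {δ : ℝ} (hδ : 0 ≤ δ) (h : SumIsBigOLogPow f δ)
    {t : ℕ} (ht : 2 ≤ t) : IrrationalSigmaPhiSeries f t := by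
  obtain ⟨C, e, hC, hsum⟩ := exists_sum_Icc_le_of_sumIsBigOLogPow hδ h
  refine ⟨irrationalSeries_of_le ht hf hC hsum (fun n => ?_) twoPowDvdOrFewFactors_sigma_one,
    irrationalSeries_of_le ht hf hC hsum le_log_succ_mul_totient twoPowDvdOrFewFactors_totient⟩
  exact (le_sigma_one n).trans (Nat.le_mul_of_pos_left _ (Nat.succ_pos _))

/-! ### The sequences d(n)^k, 2^ω(n) and 2^Ω(n) -/

lemma infinite_setOf_one_le_and_ne_zero {f : ℕ → ℕ} (h : ∀ n, 1 ≤ n → f n ≠ 0) :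
    {n : ℕ | 1 ≤ n ∧ f n ≠ 0}.Infinite :=
  (Set.Ici_infinite 1).mono fun n hn => ⟨hn, h n hn⟩

lemma sumIsBigOLogPow_card_divisors_pow (k : ℕ) :
    SumIsBigOLogPow (fun n => n.divisors.card ^ k) ((2 : ℝ) ^ k - 1) := by
  have h := sumIsBigOLogPow_of_sum_Icc_le (f := fun n => n.divisors.card ^ k) (C := 1)
    (e := 2 ^ k - 1) zero_le_one fun N => by
      push_cast
      rw [one_mul]
      exact sum_card_divisors_pow_le k N
  rwa [Nat.cast_sub Nat.one_le_two_pow, Nat.cast_pow, Nat.cast_one, Nat.cast_ofNat] at h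

open ArithmeticFunction in
lemma sumIsBigOLogPow_two_pow_cardFactors :
    SumIsBigOLogPow (fun n => 2 ^ cardFactors n) 2 := by
  obtain ⟨C, hC, h⟩ := exists_sum_two_pow_cardFactors_le
  have := sumIsBigOLogPow_of_sum_Icc_le (f := fun n => 2 ^ cardFactors n) (e := 2) hC
    fun N => by
      push_cast
      exact h N
  exact_mod_cast this

open ArithmeticFunction in
-- Since `2 ^ ω(n) ≤ d(n)`, a single logarithm already suffices; the bound is then weakened to the
-- square.
lemma sumIsBigOLogPow_two_pow_cardDistinctFactors :
    SumIsBigOLogPow (fun n => 2 ^ cardDistinctFactors n) 2 := by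
  have := sumIsBigOLogPow_of_sum_Icc_le (f := fun n => 2 ^ cardDistinctFactors n) (C := 1)
    (e := 2) zero_le_one fun N => by
      have h1 : ∑ n ∈ Icc 1 N, ((2 ^ cardDistinctFactors n : ℕ) : ℝ) ≤
          ∑ n ∈ Icc 1 N, (n.divisors.card : ℝ) ^ 1 := by
        refine Finset.sum_le_sum fun n hn => ?_
        rw [pow_one]
        have hn0 : n ≠ 0 := by have := (mem_Icc.1 hn).1; omega
        exact_mod_cast two_pow_cardDistinctFactors_le_card_divisors hn0
      refine (h1.trans (sum_card_divisors_pow_le 1 N)).trans ?_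
      rw [one_mul]
      have h2 := Real.log_natCast_nonneg N
      gcongr
      · linarith
      · norm_num
  exact_mod_cast this

end

theorem mainTheorem4 :
    (∀ f : ℕ → ℕ, {n : ℕ | 1 ≤ n ∧ f n ≠ 0}.Infinite →
      (∃ δ : ℝ, 0 < δ ∧ SumIsBigOLogPow f δ) →
      ∀ t : ℕ, 2 ≤ t → IrrationalSigmaPhiSeries f t) ∧
    (∀ k : ℕ, SumIsBigOLogPow (fun n => (Nat.divisors n).card ^ k) ((2 : ℝ) ^ k - 1) ∧
      ∀ t : ℕ, 2 ≤ t → IrrationalSigmaPhiSeries (fun n => (Nat.divisors n).card ^ k) t) ∧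
    (SumIsBigOLogPow (fun n => 2 ^ ArithmeticFunction.cardDistinctFactors n) 2 ∧
      ∀ t : ℕ, 2 ≤ t →
        IrrationalSigmaPhiSeries (fun n => 2 ^ ArithmeticFunction.cardDistinctFactors n) t) ∧
    (SumIsBigOLogPow (fun n => 2 ^ ArithmeticFunction.cardFactors n) 2 ∧
      ∀ t : ℕ, 2 ≤ t →
        IrrationalSigmaPhiSeries (fun n => 2 ^ ArithmeticFunction.cardFactors n) t) := by
  refine ⟨fun f hf ⟨δ, hδ, h⟩ t ht => irrationalSigmaPhiSeries_of_sumIsBigOLogPow hf hδ.le h ht,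
    fun k => ⟨sumIsBigOLogPow_card_divisors_pow k, fun t ht => ?_⟩,
    ⟨sumIsBigOLogPow_two_pow_cardDistinctFactors, fun t ht => ?_⟩,
    ⟨sumIsBigOLogPow_two_pow_cardFactors, fun t ht => ?_⟩⟩
  · refine irrationalSigmaPhiSeries_of_sumIsBigOLogPow
      (infinite_setOf_one_le_and_ne_zero fun n hn => ?_)
      (sub_nonneg.2 (one_le_pow₀ (by norm_num))) (sumIsBigOLogPow_card_divisors_pow k) ht
    exact pow_ne_zero k (Finset.card_ne_zero.2 (Nat.nonempty_divisors.2 (by omega)))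
  · exact irrationalSigmaPhiSeries_of_sumIsBigOLogPow
      (infinite_setOf_one_le_and_ne_zero fun n _ => pow_ne_zero _ two_ne_zero) zero_le_two
      sumIsBigOLogPow_two_pow_cardDistinctFactors ht
  · exact irrationalSigmaPhiSeries_of_sumIsBigOLogPow
      (infinite_setOf_one_le_and_ne_zero fun n _ => pow_ne_zero _ two_ne_zero) zero_le_two
      sumIsBigOLogPow_two_pow_cardFactors ht
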